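/- Let $\mathcal C$ be a symmetric monoidal category with equalizers (strict or not; associativity and unit isomorphisms are suppressed below), with tensor product $\otimes$, unit object $K$ and symmetry $c$; write $X$ also for $\mathrm{id}_X$. An object $A$ is flat if $A\otimes-$ preserves equalizers, and faithfully flat if moreover $A\otimes-$ reflects isomorphisms. A unital magma is an object $A$ with $\eta_A:K\to A$ and $\mu_A:A\otimes A\to A$ such that $\mu_A\circ(\eta_A\otimes A)=\mathrm{id}_A=\mu_A\circ(A\otimes\eta_A)$; a morphism of unital magmas preserves $\eta$ and $\mu$. The opposite $\overline A$ has product $\mu_A\circ c_{A,A}$ and the same unit; $A\otimes B$ is a unital magma with $\eta_A\otimes\eta_B$ and $(\mu_A\otimes\mu_B)\circ(A\otimes c_{B,A}\otimes B)$; and $A^e=\overline A\otimes A$. A Hopf quasigroup is a unital magma $(H,\eta_H,\mu_H)$ with a (coassociative, counital) comonoid structure $(H,\varepsilon_H,\delta_H)$ such that $\varepsilon_H$ and $\delta_H$ are morphisms of unital magmas, and with a morphism $\lambda_H:H\to H$ such that $$\mu_H\circ(\lambda_H\otimes\mu_H)\circ(\delta_H\otimes H)=\varepsilon_H\otimes H=\mu_H\circ(H\otimes\mu_H)\circ(H\otimes\lambda_H\otimes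 H)\circ(\delta_H\otimes H),$$ $$\mu_H\circ(\mu_H\otimes H)\circ(H\otimes\lambda_H\otimes H)\circ(H\otimes\delta_H)=H\otimes\varepsilon_H=\mu_H\circ(\mu_H\otimes\lambda_H)\circ(H\otimes\delta_H).$$ It is cocommutative if $c_{H,H}\circ\delta_H=\delta_H$. A right $H$-comodule magma $\mathbb A=(A,\rho_A)$ is a unital magma $A$ with a (coassociative, counital) right $H$-coaction $\rho_A:A\to A\otimes H$ that is a morphism of unital magmas; morphisms are the colinear morphisms of unital magmas. Put $\mathbb H=(H,\delta_H)$ and, for cocommutative $H$, $\overline{\mathbb A}=(\overline A,(A\otimes\lambda_H)\circ\rho_A)$. For flat $H$, the product $\mathbb A\bullet\mathbb B$ is the equalizer $i:A\bullet B\to A\otimes B$ of $\rho^1=(A\otimes c_{H,B})\circ(\rho_A\otimes B)$ and $\rho^2=A\otimes\rho_B$, with unit and product obtained by factoring $\eta_{A\otimes B}$ and $\mu_{A\otimes B}\circ(i\otimes i)$ through $i$, and coaction obtained by factoring $\rho^2\circ i$ through $i\otimes H$. A Galois $H$-object is a right $H$-comodule magma $\mathbb A$ such that $A$ is faithfully flat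 and $\gamma_A=(\mu_A\otimes H)\circ(A\otimes\rho_A):A\otimes A\to A\otimes H$ is an isomorphism. It is strong if $f_A=\gamma_A^{-1}\circ(\eta_A\otimes H):H\to A^e$ is a morphism of unital magmas. Isomorphisms of (strong) Galois $H$-objects are isomorphisms of right $H$-comodule magmas; $[\mathbb A]$ denotes the isomorphism class. Theorem. Let $H$ be a cocommutative, faithfully flat Hopf quasigroup in $\mathcal C$. (1) If $\mathbb A,\mathbb B$ are Galois $H$-objects, so is $\mathbb A\bullet\mathbb B$; $\mathbb H$ is a Galois $H$-object; and the isomorphism classes of Galois $H$-objects form a commutative monoid with product $[\mathbb A][\mathbb B]=[\mathbb A\bullet\mathbb B]$ and unit $[\mathbb H]$. (2) If $\mathbb A,\mathbb B$ are strong Galois $H$-objects, so are $\mathbb A\bullet\mathbb B$ and $\overline{\mathbb A}$; $\mathbb H$ is a strong Galois $H$-object; and the isomorphism classes of strong Galois $H$-objects form a commutative group with product $[\mathbb A][\mathbb B]=[\mathbb A\bullet\mathbb B]$, unit $[\mathbb H]$ and inverse $[\mathbb A]^{-1}=[\overline{\mathbb A}]$. -/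

import Mathlib

open CategoryTheory MonoidalCategory Limits

universe v u

namespace GaloisHopf

/-- A unital (not necessarily associative) magma in a monoidal category. -/
structure UnitalMagma (C : Type u) [Category.{v} C] [MonoidalCategory C] where
  /-- the underlying object -/
  X : C
  /-- the unit `η` -/
  one : 𝟙_ C ⟶ X
  /-- the product `μ` -/
  mul : X ⊗ X ⟶ X
  one_mul : one ▷ X ≫ mul = (λ_ X).hom
  mul_one : X ◁ one ≫ mul = (ρ_ X).hom

namespace UnitalMagma

section Basic

variable {C : Type u} [Category.{v} C] [MonoidalCategory C]


/-- `f : A ⟶ B` is a morphism of unital magmas. -/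
structure IsHom (A B : UnitalMagma C) (f : A.X ⟶ B.X) : Prop where
  one_hom : A.one ≫ f = B.one
  mul_hom : A.mul ≫ f = (f ⊗ₘ f) ≫ B.mul

theorem IsHom.id (A : UnitalMagma C) : IsHom A A (𝟙 A.X) := ⟨by simp, by simp⟩

theorem IsHom.comp {A B D : UnitalMagma C} {f : A.X ⟶ B.X} {g : B.X ⟶ D.X}
    (hf : IsHom A B f) (hg : IsHom B D g) : IsHom A D (f ≫ g) := by
  refine ⟨by rw [← Category.assoc, hf.one_hom, hg.one_hom], ?_⟩
  rw [← Category.assoc, hf.mul_hom, Category.assoc, hg.mul_hom, ← Category.assoc,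
    tensorHom_comp_tensorHom]

theorem IsHom.inv {A B : UnitalMagma C} {e : A.X ≅ B.X} (he : IsHom A B e.hom) :
    IsHom B A e.inv := by
  refine ⟨by rw [← he.one_hom]; simp, ?_⟩
  rw [Iso.comp_inv_eq, Category.assoc, he.mul_hom, ← Category.assoc, tensorHom_comp_tensorHom]
  simp

theorem IsHom.of_mono {A B D : UnitalMagma C} {f : A.X ⟶ B.X} {m : B.X ⟶ D.X} [Mono m]
    (hm : IsHom B D m) (h : IsHom A D (f ≫ m)) : IsHom A B f := by
  refine ⟨?_, ?_⟩
  · rw [← cancel_mono m, Category.assoc, h.one_hom, hm.one_hom]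
  · rw [← cancel_mono m, Category.assoc, h.mul_hom, Category.assoc, hm.mul_hom,
      ← Category.assoc, tensorHom_comp_tensorHom]

/-- The unit object with its trivial unital magma structure. -/
abbrev unit (C : Type u) [Category.{v} C] [MonoidalCategory C] : UnitalMagma C where
  X := 𝟙_ C
  one := 𝟙 _
  mul := (λ_ (𝟙_ C)).hom
  one_mul := by simp
  mul_one := by simp [unitors_equal]

/-- The unital magma on an equalizer of two morphisms of unital magmas. -/
noncomputable abbrev eqMagma {A B : UnitalMagma C} {f g : A.X ⟶ B.X} [HasEqualizer f g]
    (hf : IsHom A B f) (hg : IsHom A B g) : UnitalMagma C where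
  X := equalizer f g
  one := equalizer.lift A.one (by rw [hf.one_hom, hg.one_hom])
  mul := equalizer.lift ((equalizer.ι f g ⊗ₘ equalizer.ι f g) ≫ A.mul) (by
    rw [Category.assoc, Category.assoc, hf.mul_hom, hg.mul_hom, ← Category.assoc,
      ← Category.assoc, tensorHom_comp_tensorHom, tensorHom_comp_tensorHom,
      equalizer.condition])
  one_mul := by
    rw [← cancel_mono (equalizer.ι f g), Category.assoc, equalizer.lift_ι,
      MonoidalCategory.tensorHom_def', ← leftUnitor_naturality, ← A.one_mul]
    simp only [Category.assoc]
    rw [← whisker_exchange_assoc, ← comp_whiskerRight_assoc, equalizer.lift_ι]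
  mul_one := by
    rw [← cancel_mono (equalizer.ι f g), Category.assoc, equalizer.lift_ι,
      MonoidalCategory.tensorHom_def, ← rightUnitor_naturality, ← A.mul_one]
    simp only [Category.assoc]
    rw [whisker_exchange_assoc, ← MonoidalCategory.whiskerLeft_comp_assoc, equalizer.lift_ι]

theorem eqMagma_ι {A B : UnitalMagma C} {f g : A.X ⟶ B.X} [HasEqualizer f g]
    (hf : IsHom A B f) (hg : IsHom A B g) :
    IsHom (eqMagma hf hg) A (equalizer.ι f g) :=
  ⟨equalizer.lift_ι _ _, equalizer.lift_ι _ _⟩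

end Basic

section Braided

variable {C : Type u} [Category.{v} C] [MonoidalCategory C] [SymmetricCategory C]

/-- The tensor product of unital magmas: `η = η_A ⊗ η_B`,
`μ = (μ_A ⊗ μ_B) ∘ (A ⊗ c_{B,A} ⊗ B)`. -/
abbrev tensor (A B : UnitalMagma C) : UnitalMagma C where
  X := A.X ⊗ B.X
  one := (λ_ (𝟙_ C)).inv ≫ (A.one ⊗ₘ B.one)
  mul := tensorμ A.X B.X A.X B.X ≫ (A.mul ⊗ₘ B.mul)
  one_mul := by
    rw [comp_whiskerRight, Category.assoc, tensorμ_natural_left_assoc]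
    rw [tensorHom_comp_tensorHom, A.one_mul, B.one_mul, tensor_left_unitality]
  mul_one := by
    rw [MonoidalCategory.whiskerLeft_comp, Category.assoc, tensorμ_natural_right_assoc]
    rw [tensorHom_comp_tensorHom, A.mul_one, B.mul_one, tensor_right_unitality]

/-- The opposite unital magma, with product `μ ∘ c`. -/
abbrev op (A : UnitalMagma C) : UnitalMagma C where
  X := A.X
  one := A.one
  mul := (β_ A.X A.X).hom ≫ A.mul
  one_mul := by simp [A.mul_one]
  mul_one := by simp [A.one_mul]

/-- `A^e`, the tensor product of the opposite of `A` with `A`. -/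
abbrev env (A : UnitalMagma C) : UnitalMagma C := A.op.tensor A

theorem IsHom.tensor {A B D E : UnitalMagma C} {f : A.X ⟶ B.X} {g : D.X ⟶ E.X}
    (hf : IsHom A B f) (hg : IsHom D E g) :
    IsHom (A.tensor D) (B.tensor E) (f ⊗ₘ g) := by
  refine ⟨?_, ?_⟩
  · rw [Category.assoc, tensorHom_comp_tensorHom, hf.one_hom, hg.one_hom]
  · rw [Category.assoc, tensorHom_comp_tensorHom, hf.mul_hom, hg.mul_hom,
      tensorμ_natural_assoc, tensorHom_comp_tensorHom]

theorem IsHom.whiskerRight {A B : UnitalMagma C} {f : A.X ⟶ B.X} (hf : IsHom A B f)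
    (D : UnitalMagma C) : IsHom (A.tensor D) (B.tensor D) (f ▷ D.X) := by
  simpa using hf.tensor (IsHom.id D)

theorem IsHom.whiskerLeft (D : UnitalMagma C) {A B : UnitalMagma C} {f : A.X ⟶ B.X}
    (hf : IsHom A B f) : IsHom (D.tensor A) (D.tensor B) (D.X ◁ f) := by
  simpa using (IsHom.id D).tensor hf

theorem isHom_associator (A B D : UnitalMagma C) :
    IsHom ((A.tensor B).tensor D) (A.tensor (B.tensor D)) (α_ A.X B.X D.X).hom := by
  refine ⟨?_, ?_⟩
  · simp only [MonoidalCategory.tensorHom_def]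
    monoidal
  · have h1 : (tensorμ A.X B.X A.X B.X ≫ (A.mul ⊗ₘ B.mul)) ⊗ₘ D.mul =
        (tensorμ A.X B.X A.X B.X ▷ _) ≫ ((A.mul ⊗ₘ B.mul) ⊗ₘ D.mul) := by
      rw [← tensorHom_id, tensorHom_comp_tensorHom, Category.id_comp]
    have h2 : A.mul ⊗ₘ (tensorμ B.X D.X B.X D.X ≫ (B.mul ⊗ₘ D.mul)) =
        (_ ◁ tensorμ B.X D.X B.X D.X) ≫ (A.mul ⊗ₘ (B.mul ⊗ₘ D.mul)) := by
      rw [← id_tensorHom, tensorHom_comp_tensorHom, Category.id_comp]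
    dsimp only [tensor]
    rw [h1, h2, Category.assoc, Category.assoc, associator_naturality,
      associator_monoidal_assoc]

theorem isHom_associator_inv (A B D : UnitalMagma C) :
    IsHom (A.tensor (B.tensor D)) ((A.tensor B).tensor D) (α_ A.X B.X D.X).inv :=
  (isHom_associator A B D).inv

theorem tensorμ_braiding (X Y : C) :
    tensorμ X Y X Y ≫ (β_ (X ⊗ X) (Y ⊗ Y)).hom =
      ((β_ X Y).hom ⊗ₘ (β_ X Y).hom) ≫ tensorμ Y X Y X := by
  simp only [tensorμ, Category.assoc,
    BraidedCategory.braiding_tensor_right_hom, BraidedCategory.braiding_tensor_left_hom,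
    comp_whiskerRight, whisker_assoc, MonoidalCategory.whiskerLeft_comp, pentagon_assoc,
    pentagon_inv_hom_hom_hom_inv_assoc, Iso.inv_hom_id_assoc, whiskerLeft_hom_inv_assoc]
  slice_lhs 3 4 =>
    rw [← MonoidalCategory.whiskerLeft_comp, ← comp_whiskerRight, SymmetricCategory.symmetry]
  simp only [id_whiskerRight, MonoidalCategory.whiskerLeft_id, Category.id_comp, Category.assoc,
    pentagon_inv_assoc, Iso.hom_inv_id_assoc]
  slice_lhs 1 2 => rw [← associator_inv_naturality_left]
  slice_lhs 2 3 => rw [Iso.inv_hom_id]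
  rw [Category.id_comp]
  slice_lhs 2 3 => rw [← associator_naturality_right]
  slice_lhs 1 2 => rw [← MonoidalCategory.tensorHom_def]
  simp only [Category.assoc]

theorem isHom_braiding (A B : UnitalMagma C) :
    IsHom (A.tensor B) (B.tensor A) (β_ A.X B.X).hom := by
  refine ⟨?_, ?_⟩
  · rw [Category.assoc, BraidedCategory.braiding_naturality, braiding_tensorUnit_left]
    simp [unitors_equal]
  · rw [Category.assoc, BraidedCategory.braiding_naturality]
    simp only [← Category.assoc]
    rw [tensorμ_braiding]

/-- The opposite of a tensor product is the tensor product of the opposites. -/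
theorem isHom_op_tensor (A B : UnitalMagma C) :
    IsHom (A.tensor B).op (A.op.tensor B.op) (𝟙 (A.X ⊗ B.X)) := by
  refine ⟨Category.comp_id _, ?_⟩
  rw [id_tensorHom_id, Category.id_comp, Category.comp_id]
  dsimp only [tensor, op]
  rw [← tensorHom_comp_tensorHom]
  simp only [← Category.assoc]
  congr 1
  simp [tensorμ, SymmetricCategory.braiding_swap_eq_inv_braiding B.X A.X,
    MonoidalCategory.tensorHom_def]

theorem IsHom.op {A B : UnitalMagma C} {f : A.X ⟶ B.X} (hf : IsHom A B f) :
    IsHom A.op B.op f := by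
  refine ⟨hf.one_hom, ?_⟩
  rw [Category.assoc, hf.mul_hom, BraidedCategory.braiding_naturality_assoc]

end Braided

end UnitalMagma

open scoped ComonObj

/-- A Hopf quasigroup in a symmetric monoidal category. -/
structure HopfQuasigroup (C : Type u) [Category.{v} C] [MonoidalCategory C]
    [SymmetricCategory C] extends UnitalMagma C where
  /-- the (coassociative, counital) comonoid structure on the underlying object -/
  [comon : ComonObj X]
  counit_isHom : UnitalMagma.IsHom toUnitalMagma (UnitalMagma.unit C) ε[X]
  comul_isHom : UnitalMagma.IsHom toUnitalMagma (toUnitalMagma.tensor toUnitalMagma) Δ[X]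
  /-- the antipode `λ` -/
  antipode : X ⟶ X
  /-- `λ(h₁)(h₂ x) = ε(h) x` -/
  antipode_mul_mul :
    Δ[X] ▷ X ≫ (α_ X X X).hom ≫ (antipode ⊗ₘ mul) ≫ mul = ε[X] ▷ X ≫ (λ_ X).hom
  /-- `h₁(λ(h₂) x) = ε(h) x` -/
  mul_antipode_mul :
    Δ[X] ▷ X ≫ (α_ X X X).hom ≫ X ◁ (antipode ▷ X ≫ mul) ≫ mul = ε[X] ▷ X ≫ (λ_ X).hom
  /-- `(x λ(h₁)) h₂ = x ε(h)` -/
  mul_antipode_mul' :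
    X ◁ Δ[X] ≫ (α_ X X X).inv ≫ (X ◁ antipode ≫ mul) ▷ X ≫ mul = X ◁ ε[X] ≫ (ρ_ X).hom
  /-- `(x h₁) λ(h₂) = x ε(h)` -/
  mul_mul_antipode :
    X ◁ Δ[X] ≫ (α_ X X X).inv ≫ (mul ⊗ₘ antipode) ≫ mul = X ◁ ε[X] ≫ (ρ_ X).hom

attribute [instance] HopfQuasigroup.comon

namespace HopfQuasigroup

section Convolution

variable {C : Type u} [Category.{v} C] [MonoidalCategory C]

/-- Convolution `d ↦ y(d₁) · f(d₂)` with respect to a pairing `a`. -/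
def conv {D M N P : C} [ComonObj D] (a : M ⊗ N ⟶ P) (y : D ⟶ M) (f : D ⟶ N) : D ⟶ P :=
  Δ[D] ≫ (y ⊗ₘ f) ≫ a

theorem conv_cancel_right {D M H : C} [ComonObj D] [ComonObj H] (a : M ⊗ H ⟶ M) (s : H ⟶ H)
    (ha : M ◁ Δ[H] ≫ (α_ M H H).inv ≫ (a ⊗ₘ s) ≫ a = M ◁ ε[H] ≫ (ρ_ M).hom)
    (y : D ⟶ M) (f : D ⟶ H) [IsComonHom f] : conv a (conv a y f) (f ≫ s) = y := by
  have e1 : (Δ[D] ≫ (y ⊗ₘ f) ≫ a) ⊗ₘ (f ≫ s) =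
      Δ[D] ▷ D ≫ ((y ⊗ₘ f) ⊗ₘ f) ≫ (a ⊗ₘ s) := by
    rw [tensorHom_comp_tensorHom, ← tensorHom_id, tensorHom_comp_tensorHom, Category.id_comp]
  have e2 : Δ[D] ≫ Δ[D] ▷ D = Δ[D] ≫ D ◁ Δ[D] ≫ (α_ D D D).inv := by simp
  have e3 : D ◁ Δ[D] ≫ (y ⊗ₘ (f ⊗ₘ f)) = (y ⊗ₘ f) ≫ M ◁ Δ[H] := by
    rw [← id_tensorHom, ← id_tensorHom, tensorHom_comp_tensorHom, tensorHom_comp_tensorHom,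
      IsComonHom.hom_comul]
    simp
  have e4 : (y ⊗ₘ f) ≫ M ◁ ε[H] = y ⊗ₘ ε[D] := by
    rw [← id_tensorHom, tensorHom_comp_tensorHom, IsComonHom.hom_counit, Category.comp_id]
  unfold conv
  rw [e1]
  simp only [Category.assoc]
  rw [reassoc_of% e2, ← associator_inv_naturality_assoc, reassoc_of% e3, ha, reassoc_of% e4]
  simp

theorem conv_cancel_left {D M H : C} [ComonObj D] [ComonObj H] (a : H ⊗ M ⟶ M) (s : H ⟶ H)
    (ha : Δ[H] ▷ M ≫ (α_ H H M).hom ≫ (s ⊗ₘ a) ≫ a = ε[H] ▷ M ≫ (λ_ M).hom)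
    (y : D ⟶ M) (f : D ⟶ H) [IsComonHom f] : conv a (f ≫ s) (conv a f y) = y := by
  have e1 : (f ≫ s) ⊗ₘ (Δ[D] ≫ (f ⊗ₘ y) ≫ a) =
      D ◁ Δ[D] ≫ (f ⊗ₘ (f ⊗ₘ y)) ≫ (s ⊗ₘ a) := by
    rw [tensorHom_comp_tensorHom, ← id_tensorHom, tensorHom_comp_tensorHom, Category.id_comp]
  have e2 : Δ[D] ≫ D ◁ Δ[D] = Δ[D] ≫ Δ[D] ▷ D ≫ (α_ D D D).hom := by simp
  have e3 : Δ[D] ▷ D ≫ ((f ⊗ₘ f) ⊗ₘ y) = (f ⊗ₘ y) ≫ Δ[H] ▷ M := by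
    rw [← tensorHom_id, ← tensorHom_id, tensorHom_comp_tensorHom, tensorHom_comp_tensorHom,
      IsComonHom.hom_comul]
    simp
  have e4 : (f ⊗ₘ y) ≫ ε[H] ▷ M = ε[D] ⊗ₘ y := by
    rw [← tensorHom_id, tensorHom_comp_tensorHom, IsComonHom.hom_counit, Category.comp_id]
  unfold conv
  rw [e1]
  simp only [Category.assoc]
  rw [reassoc_of% e2, ← associator_naturality_assoc, reassoc_of% e3, ha, reassoc_of% e4]
  simp

theorem comp_conv {D E M N P : C} [ComonObj D] [ComonObj E] (g : E ⟶ D) [IsComonHom g]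
    (a : M ⊗ N ⟶ P) (y : D ⟶ M) (f : D ⟶ N) :
    g ≫ conv a y f = conv a (g ≫ y) (g ≫ f) := by
  simp [conv, tensorHom_comp_tensorHom_assoc]

theorem conv_counit {D M N P : C} [ComonObj D] (a : M ⊗ N ⟶ P) (y : D ⟶ M) (n : 𝟙_ C ⟶ N) :
    conv a y (ε[D] ≫ n) = y ≫ (ρ_ M).inv ≫ M ◁ n ≫ a := by
  have : (y ⊗ₘ (ε[D] ≫ n)) = (y ⊗ₘ ε[D]) ≫ M ◁ n := by
    rw [← id_tensorHom, tensorHom_comp_tensorHom, Category.comp_id]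
  rw [conv, this, Category.assoc, ComonObj.comul_counit_hom_assoc]

theorem counit_conv {D M N P : C} [ComonObj D] (a : M ⊗ N ⟶ P) (m : 𝟙_ C ⟶ M) (f : D ⟶ N) :
    conv a (ε[D] ≫ m) f = f ≫ (λ_ N).inv ≫ m ▷ N ≫ a := by
  have : ((ε[D] ≫ m) ⊗ₘ f) = (ε[D] ⊗ₘ f) ≫ m ▷ N := by
    rw [← tensorHom_id, tensorHom_comp_tensorHom, Category.comp_id]
  rw [conv, this, Category.assoc, ComonObj.counit_comul_hom_assoc]

end Convolution

variable {C : Type u} [Category.{v} C] [MonoidalCategory C] [SymmetricCategory C]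
  (H : HopfQuasigroup C)

theorem antipode_conv_id : conv H.mul H.antipode (𝟙 H.X) = ε[H.X] ≫ H.one := by
  have h := conv_cancel_left H.mul H.antipode H.antipode_mul_mul (ε[H.X] ≫ H.one) (𝟙 H.X)
  rw [conv_counit, H.mul_one] at h
  simpa using h

theorem antipode_counit : H.antipode ≫ ε[H.X] = ε[H.X] := by
  have h := congrArg (· ≫ ε[H.X]) H.antipode_conv_id
  have h1 := H.counit_isHom.one_hom
  have h2 := H.counit_isHom.mul_hom
  dsimp only at h h1 h2
  rw [Category.assoc, h1, Category.comp_id, conv, Category.assoc, Category.assoc, h2,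
    tensorHom_comp_tensorHom_assoc, Category.id_comp, ComonObj.comul_counit_hom_assoc] at h
  simpa [unitors_equal] using h

theorem one_antipode : H.one ≫ H.antipode = H.one := by
  have h := congrArg (H.one ≫ ·) H.antipode_conv_id
  have h1 := H.counit_isHom.one_hom
  have h2 := H.comul_isHom.one_hom
  dsimp only at h h1 h2
  rw [conv, reassoc_of% h1, reassoc_of% h2, tensorHom_comp_tensorHom_assoc, Category.comp_id,
    MonoidalCategory.tensorHom_def, Category.assoc, H.mul_one] at h
  simpa [← unitors_equal] using h

/-- The antipode is antimultiplicative. -/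
theorem mul_antipode :
    H.mul ≫ H.antipode = (β_ H.X H.X).hom ≫ (H.antipode ⊗ₘ H.antipode) ≫ H.mul := by
  -- the two projections and the product, as comonoid morphisms `H ⊗ H ⟶ H`
  let p : H.X ⊗ H.X ⟶ H.X := (𝟙 H.X ⊗ₘ ε[H.X]) ≫ (ρ_ H.X).hom
  let q : H.X ⊗ H.X ⟶ H.X := (ε[H.X] ⊗ₘ 𝟙 H.X) ≫ (λ_ H.X).hom
  have hmul : IsComonHom H.mul :=
    { hom_counit := by
        rw [H.counit_isHom.mul_hom]
        rfl
      hom_comul := by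
        rw [H.comul_isHom.mul_hom]
        simp }
  have hp : IsComonHom p :=
    { hom_counit := by
        simp [p, MonoidalCategory.tensorHom_def', unitors_equal]
      hom_comul := by
        have e : Δ[H.X] ≫ (ε[H.X] ⊗ₘ ε[H.X]) = ε[H.X] ≫ (λ_ (𝟙_ C)).inv := by simp [unitors_inv_equal]
        have e' : Δ[H.X] ⊗ₘ (ε[H.X] ≫ (λ_ (𝟙_ C)).inv) =
            (Δ[H.X] ⊗ₘ ε[H.X]) ≫ (H.X ⊗ H.X) ◁ (λ_ (𝟙_ C)).inv := by
          rw [← id_tensorHom, tensorHom_comp_tensorHom, Category.comp_id]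
        simp only [p, ← tensorHom_comp_tensorHom, Comon.tensorObj_comul, Category.assoc]
        rw [← tensorμ_natural_assoc, tensorHom_comp_tensorHom_assoc, e, id_tensorHom_id,
          Category.comp_id, e', Category.assoc, ← tensor_right_unitality,
          ← rightUnitor_naturality, ← tensorHom_id, tensorHom_comp_tensorHom_assoc,
          Category.id_comp, Category.comp_id] }
  have hq : IsComonHom q :=
    { hom_counit := by
        simp [q, MonoidalCategory.tensorHom_def]
      hom_comul := by
        have e : Δ[H.X] ≫ (ε[H.X] ⊗ₘ ε[H.X]) = ε[H.X] ≫ (λ_ (𝟙_ C)).inv := by simp [unitors_inv_equal]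
        have e' : (ε[H.X] ≫ (λ_ (𝟙_ C)).inv) ⊗ₘ Δ[H.X] =
            (ε[H.X] ⊗ₘ Δ[H.X]) ≫ (λ_ (𝟙_ C)).inv ▷ (H.X ⊗ H.X) := by
          rw [← tensorHom_id, tensorHom_comp_tensorHom, Category.comp_id]
        simp only [q, ← tensorHom_comp_tensorHom, Comon.tensorObj_comul, Category.assoc]
        rw [← tensorμ_natural_assoc, tensorHom_comp_tensorHom_assoc, e, id_tensorHom_id,
          Category.comp_id, e', Category.assoc, ← tensor_left_unitality,
          ← leftUnitor_naturality, ← id_tensorHom, tensorHom_comp_tensorHom_assoc,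
          Category.id_comp, Category.comp_id] }
  have hpq (s t : H.X ⟶ H.X) : conv H.mul (p ≫ s) (q ≫ t) = (s ⊗ₘ t) ≫ H.mul := by
    have : Δ[H.X ⊗ H.X] ≫ (p ⊗ₘ q) = 𝟙 _ := by
      simp only [p, q, ← tensorHom_comp_tensorHom, Comon.tensorObj_comul, Category.assoc]
      rw [← tensorμ_natural_assoc, tensorHom_comp_tensorHom_assoc,
        ComonObj.counit_comul_hom, ComonObj.comul_counit_hom]
      have e : (β_ (𝟙_ C) (𝟙_ C)).hom = 𝟙 _ := by simp [← unitors_equal]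
      simp only [tensorμ, e, MonoidalCategory.tensorHom_def, Category.id_comp]
      monoidal
    rw [conv, ← tensorHom_comp_tensorHom, Category.assoc, reassoc_of% this]
  have hqp (s t : H.X ⟶ H.X) :
      conv H.mul (q ≫ s) (p ≫ t) = (β_ H.X H.X).hom ≫ (s ⊗ₘ t) ≫ H.mul := by
    have : Δ[H.X ⊗ H.X] ≫ (q ⊗ₘ p) = (β_ H.X H.X).hom := by
      simp only [p, q, ← tensorHom_comp_tensorHom, Comon.tensorObj_comul, Category.assoc]
      rw [← tensorμ_natural_assoc, tensorHom_comp_tensorHom_assoc,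
        ComonObj.counit_comul_hom, ComonObj.comul_counit_hom]
      simp only [tensorμ, MonoidalCategory.tensorHom_def, Category.id_comp]
      monoidal
    rw [conv, ← tensorHom_comp_tensorHom, Category.assoc, reassoc_of% this]
  have hm : conv H.mul p q = H.mul := by simpa using hpq (𝟙 _) (𝟙 _)
  have c1 := conv_cancel_right H.mul H.antipode H.mul_mul_antipode p q
  rw [hm] at c1
  have c2 := conv_cancel_left H.mul H.antipode H.antipode_mul_mul (q ≫ H.antipode) H.mul
  rw [c1] at c2
  have c3 := conv_cancel_right H.mul H.antipode H.mul_mul_antipode (H.mul ≫ H.antipode) p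
  rw [c2, hqp] at c3
  exact c3.symm

/-- The antipode is anticomultiplicative. -/
theorem antipode_comul :
    H.antipode ≫ Δ[H.X] = Δ[H.X] ≫ (β_ H.X H.X).hom ≫ (H.antipode ⊗ₘ H.antipode) := by
  let a₂ : (H.X ⊗ H.X) ⊗ H.X ⟶ H.X ⊗ H.X := (α_ H.X H.X H.X).hom ≫ H.X ◁ H.mul
  let a₁ : (H.X ⊗ H.X) ⊗ H.X ⟶ H.X ⊗ H.X := (β_ H.X H.X).hom ▷ H.X ≫ a₂ ≫ (β_ H.X H.X).hom
  have ha₁' : a₁ = (α_ H.X H.X H.X).hom ≫ H.X ◁ (β_ H.X H.X).hom ≫ (α_ H.X H.X H.X).inv ≫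
      H.mul ▷ H.X := by
    have e2 : (β_ H.X H.X).hom ▷ H.X ≫ (β_ H.X H.X).hom ▷ H.X = 𝟙 _ := by
      rw [← comp_whiskerRight, SymmetricCategory.symmetry, id_whiskerRight]
    simp [a₁, a₂, reassoc_of% e2]
  have ha₂ : (H.X ⊗ H.X) ◁ Δ[H.X] ≫ (α_ _ _ _).inv ≫ (a₂ ⊗ₘ H.antipode) ≫ a₂ =
      (H.X ⊗ H.X) ◁ ε[H.X] ≫ (ρ_ _).hom := by
    have h := congrArg (fun f => (α_ H.X H.X (H.X)).hom ≫ H.X ◁ f) H.mul_mul_antipode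
    simp only [MonoidalCategory.tensorHom_def] at h ⊢
    refine Eq.trans ?_ (h.trans ?_)
    · simp only [a₂]
      monoidal
    · monoidal
  have ha₁ : (H.X ⊗ H.X) ◁ Δ[H.X] ≫ (α_ _ _ _).inv ≫ (a₁ ⊗ₘ H.antipode) ≫ a₁ =
      (H.X ⊗ H.X) ◁ ε[H.X] ≫ (ρ_ _).hom := by
    have e1 : a₁ ⊗ₘ H.antipode = (β_ H.X H.X).hom ▷ H.X ▷ H.X ≫ (a₂ ⊗ₘ H.antipode) ≫
        (β_ H.X H.X).hom ▷ H.X := by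
      simp only [a₁, ← tensorHom_id, tensorHom_comp_tensorHom, Category.id_comp,
        Category.comp_id]
    have e2 : (β_ H.X H.X).hom ▷ H.X ≫ (β_ H.X H.X).hom ▷ H.X = 𝟙 _ := by
      rw [← comp_whiskerRight, SymmetricCategory.symmetry, id_whiskerRight]
    rw [e1]
    simp only [a₁, Category.assoc]
    rw [reassoc_of% e2, ← associator_inv_naturality_left_assoc, whisker_exchange_assoc,
      reassoc_of% ha₂, ← whisker_exchange_assoc, rightUnitor_naturality_assoc,
      SymmetricCategory.symmetry, Category.comp_id]
  have hT : (α_ (H.X ⊗ H.X) H.X H.X).inv ≫ a₁ ▷ H.X ≫ a₂ =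
      tensorμ H.X H.X H.X H.X ≫ (H.mul ⊗ₘ H.mul) := by
    simp only [ha₁', a₂, tensorμ, MonoidalCategory.tensorHom_def]
    monoidal
  let e : 𝟙_ C ⟶ H.X ⊗ H.X := (λ_ (𝟙_ C)).inv ≫ (H.one ⊗ₘ H.one)
  have h1 : conv a₂ (conv a₁ (H.antipode ≫ Δ[H.X]) (𝟙 _)) (𝟙 _) = ε[H.X] ≫ e := by
    have h := congrArg (· ≫ Δ[H.X]) H.antipode_conv_id
    have k1 := H.comul_isHom.one_hom
    have k2 := H.comul_isHom.mul_hom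
    dsimp only at h k1 k2
    rw [Category.assoc, k1] at h
    rw [← h]
    simp only [conv, Category.assoc, k2, ← hT]
    have e1 : (Δ[H.X] ≫ (H.antipode ≫ Δ[H.X] ⊗ₘ 𝟙 H.X) ≫ a₁) ⊗ₘ 𝟙 H.X =
        Δ[H.X] ▷ H.X ≫ (((H.antipode ≫ Δ[H.X]) ⊗ₘ 𝟙 H.X) ⊗ₘ 𝟙 H.X) ≫ a₁ ▷ H.X := by
      simp only [← tensorHom_id, tensorHom_comp_tensorHom, Category.comp_id]
    have e2 : Δ[H.X] ≫ Δ[H.X] ▷ H.X = Δ[H.X] ≫ H.X ◁ Δ[H.X] ≫ (α_ H.X H.X H.X).inv := by simp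
    rw [e1]
    simp only [Category.assoc]
    rw [reassoc_of% e2, ← associator_inv_naturality_assoc, ← id_tensorHom,
      tensorHom_comp_tensorHom_assoc, tensorHom_comp_tensorHom_assoc]
    simp
  have h2 := conv_cancel_right a₂ H.antipode ha₂ (conv a₁ (H.antipode ≫ Δ[H.X]) (𝟙 _)) (𝟙 _)
  rw [h1] at h2
  have h3 := conv_cancel_right a₁ H.antipode ha₁ (H.antipode ≫ Δ[H.X]) (𝟙 _)
  rw [← h2, counit_conv] at h3
  rw [← h3]
  simp only [conv, ha₁', a₂, e, Category.id_comp]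
  have e1 : (λ_ H.X).inv ≫ ((λ_ (𝟙_ C)).inv ≫ (H.one ⊗ₘ H.one)) ▷ H.X ≫
      (α_ H.X H.X H.X).hom ≫ H.X ◁ H.mul = (λ_ H.X).inv ≫ H.one ▷ H.X := by
    have k := H.one_mul
    calc _ = (λ_ H.X).inv ≫ (λ_ _).inv ≫ H.one ▷ (𝟙_ C ⊗ H.X) ≫ H.X ◁ (H.one ▷ H.X ≫ H.mul) := by
          simp only [MonoidalCategory.tensorHom_def]
          monoidal
      _ = _ := by
          rw [k]
          monoidal
  have e2 : (H.antipode ≫ (λ_ H.X).inv ≫ H.one ▷ H.X) ⊗ₘ H.antipode =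
      (H.antipode ⊗ₘ H.antipode) ≫ ((λ_ H.X).inv ≫ H.one ▷ H.X) ▷ H.X := by
    generalize (λ_ H.X).inv ≫ H.one ▷ H.X = w
    rw [← tensorHom_id, tensorHom_comp_tensorHom, Category.comp_id]
  have e3 : ((λ_ H.X).inv ≫ H.one ▷ H.X) ▷ H.X ≫ (α_ H.X H.X H.X).hom ≫
      H.X ◁ (β_ H.X H.X).hom ≫ (α_ H.X H.X H.X).inv ≫ H.mul ▷ H.X = (β_ H.X H.X).hom := by
    have k := H.one_mul
    calc _ = (λ_ _).inv ≫ (H.one ▷ (H.X ⊗ H.X) ≫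
          H.X ◁ (β_ H.X H.X).hom) ≫ (α_ H.X H.X H.X).inv ≫ H.mul ▷ H.X := by monoidal
      _ = (λ_ _).inv ≫ (𝟙_ C) ◁ (β_ H.X H.X).hom ≫ (α_ _ _ _).inv ≫
          (H.one ▷ H.X ≫ H.mul) ▷ H.X := by
          rw [← whisker_exchange]
          monoidal
      _ = _ := by
          rw [k]
          monoidal
  rw [e1, e2, Category.assoc, e3, BraidedCategory.braiding_naturality]

end HopfQuasigroup

/-- `A` is flat: the functor `A ⊗ -` preserves equalizers. -/
class Flat {C : Type u} [Category.{v} C] [MonoidalCategory C] (A : C) : Prop where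
  preservesEqualizers : PreservesLimitsOfShape WalkingParallelPair (tensorLeft A)

/-- `A` is faithfully flat: it is flat and the functor `A ⊗ -` reflects isomorphisms. -/
class FaithfullyFlat {C : Type u} [Category.{v} C] [MonoidalCategory C] (A : C) : Prop
    extends Flat A where
  reflectsIsos : (tensorLeft A).ReflectsIsomorphisms

theorem Flat.preserves_right {C : Type u} [Category.{v} C] [MonoidalCategory C]
    [SymmetricCategory C] (A : C) [h : Flat A] :
    PreservesLimitsOfShape WalkingParallelPair (tensorRight A) :=
  have := h.preservesEqualizers
  preservesLimitsOfShape_of_natIso (BraidedCategory.tensorLeftIsoTensorRight A)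

section ComoduleMagma

variable {C : Type u} [Category.{v} C] [MonoidalCategory C] [SymmetricCategory C]

/-- A right `H`-comodule magma: a unital magma with a right `H`-coaction which is a morphism of
unital magmas. -/
structure ComoduleMagma (H : HopfQuasigroup C) extends UnitalMagma C where
  /-- the coaction `ρ` -/
  coact : X ⟶ X ⊗ H.X
  coact_coassoc : coact ≫ coact ▷ H.X = coact ≫ X ◁ Δ[H.X] ≫ (α_ X H.X H.X).inv
  coact_counit : coact ≫ X ◁ ε[H.X] = (ρ_ X).inv
  coact_isHom : UnitalMagma.IsHom toUnitalMagma (toUnitalMagma.tensor H.toUnitalMagma) coact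

namespace ComoduleMagma

variable {H : HopfQuasigroup C}

/-- Morphisms of right `H`-comodule magmas: morphisms of unital magmas that are colinear. -/
@[ext]
structure Hom (A B : ComoduleMagma H) where
  /-- the underlying morphism -/
  hom : A.X ⟶ B.X
  isHom : UnitalMagma.IsHom A.toUnitalMagma B.toUnitalMagma hom
  colinear : hom ≫ B.coact = A.coact ≫ hom ▷ H.X

/-- The category of right `H`-comodule magmas. -/
instance : Category (ComoduleMagma H) where
  Hom := Hom
  id A := ⟨𝟙 A.X, .id _, by simp⟩
  comp f g := ⟨f.hom ≫ g.hom, f.isHom.comp g.isHom, by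
    rw [Category.assoc, g.colinear, reassoc_of% f.colinear, comp_whiskerRight]⟩
  id_comp f := Hom.ext (Category.id_comp f.hom)
  comp_id f := Hom.ext (Category.comp_id f.hom)
  assoc f g h := Hom.ext (Category.assoc f.hom g.hom h.hom)

/-- `H` as a right comodule magma over itself, with coaction the coproduct. -/
def regular (H : HopfQuasigroup C) : ComoduleMagma H where
  toUnitalMagma := H.toUnitalMagma
  coact := Δ[H.X]
  coact_coassoc := by simp
  coact_counit := by simp
  coact_isHom := H.comul_isHom

/-- The opposite comodule magma of `A` over a cocommutative Hopf quasigroup: the opposite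
unital magma with coaction `(A ⊗ λ) ∘ ρ_A`. -/
def op [IsCommComonObj H.X] (A : ComoduleMagma H) : ComoduleMagma H where
  toUnitalMagma := A.toUnitalMagma.op
  coact := A.coact ≫ A.X ◁ H.antipode
  coact_coassoc := by
    have h1 := A.coact_coassoc
    have h2 := H.antipode_comul
    rw [IsCommComonObj.comul_comm_assoc] at h2
    have h3 : A.X ◁ H.antipode ≫ (A.X ◁ Δ[H.X]) =
        A.X ◁ Δ[H.X] ≫ A.X ◁ (H.antipode ⊗ₘ H.antipode) := by
      rw [← MonoidalCategory.whiskerLeft_comp, h2, MonoidalCategory.whiskerLeft_comp]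
    have h4 : A.X ◁ H.antipode ≫ A.coact ▷ H.X =  A.coact ▷ H.X ≫ (A.X ⊗ H.X) ◁ H.antipode := by
      rw [whisker_exchange]
    simp only [Category.assoc, comp_whiskerRight]
    rw [reassoc_of% h4, reassoc_of% h1, reassoc_of% h3]
    simp [MonoidalCategory.tensorHom_def']
  coact_counit := by
    rw [Category.assoc, ← MonoidalCategory.whiskerLeft_comp, H.antipode_counit, A.coact_counit]
  coact_isHom := by
    have hs : UnitalMagma.IsHom H.toUnitalMagma.op H.toUnitalMagma H.antipode := by
      refine ⟨H.one_antipode, ?_⟩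
      rw [Category.assoc, H.mul_antipode, SymmetricCategory.symmetry_assoc]
    have := (A.coact_isHom.op.comp (UnitalMagma.isHom_op_tensor _ _)).comp
      (hs.whiskerLeft A.toUnitalMagma.op)
    rwa [Category.comp_id] at this

/-- The coaction `ρ¹ = (A ⊗ c_{H,B}) ∘ (ρ_A ⊗ B)` on `A ⊗ B`. -/
def coact₁ (A B : ComoduleMagma H) : A.X ⊗ B.X ⟶ (A.X ⊗ B.X) ⊗ H.X :=
  A.coact ▷ B.X ≫ (α_ A.X H.X B.X).hom ≫ A.X ◁ (β_ H.X B.X).hom ≫ (α_ A.X B.X H.X).inv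

/-- The coaction `ρ² = A ⊗ ρ_B` on `A ⊗ B`. -/
def coact₂ (A B : ComoduleMagma H) : A.X ⊗ B.X ⟶ (A.X ⊗ B.X) ⊗ H.X :=
  A.X ◁ B.coact ≫ (α_ A.X B.X H.X).inv

theorem coact₁_isHom (A B : ComoduleMagma H) :
    UnitalMagma.IsHom (A.toUnitalMagma.tensor B.toUnitalMagma)
      ((A.toUnitalMagma.tensor B.toUnitalMagma).tensor H.toUnitalMagma) (coact₁ A B) :=
  (A.coact_isHom.whiskerRight B.toUnitalMagma).comp
    ((UnitalMagma.isHom_associator _ _ _).comp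
      (((UnitalMagma.isHom_braiding H.toUnitalMagma B.toUnitalMagma).whiskerLeft
        A.toUnitalMagma).comp (UnitalMagma.isHom_associator_inv _ _ _)))

theorem coact₂_isHom (A B : ComoduleMagma H) :
    UnitalMagma.IsHom (A.toUnitalMagma.tensor B.toUnitalMagma)
      ((A.toUnitalMagma.tensor B.toUnitalMagma).tensor H.toUnitalMagma) (coact₂ A B) :=
  (B.coact_isHom.whiskerLeft A.toUnitalMagma).comp (UnitalMagma.isHom_associator_inv _ _ _)

theorem coact₂_coassoc (A B : ComoduleMagma H) :
    coact₂ A B ≫ coact₂ A B ▷ H.X =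
      coact₂ A B ≫ (A.X ⊗ B.X) ◁ Δ[H.X] ≫ (α_ (A.X ⊗ B.X) H.X H.X).inv := by
  have h := congrArg (A.X ◁ ·) B.coact_coassoc
  unfold coact₂
  calc _ = A.X ◁ (B.coact ≫ B.coact ▷ H.X) ≫ (α_ _ _ _).inv ≫ (α_ _ _ _).inv ▷ H.X := by
        monoidal
    _ = _ := by
        rw [h]
        monoidal

theorem coact₂_counit (A B : ComoduleMagma H) :
    coact₂ A B ≫ (A.X ⊗ B.X) ◁ ε[H.X] = (ρ_ (A.X ⊗ B.X)).inv := by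
  have h := congrArg (A.X ◁ ·) B.coact_counit
  unfold coact₂
  calc _ = A.X ◁ (B.coact ≫ B.X ◁ ε[H.X]) ≫ (α_ _ _ _).inv := by monoidal
    _ = _ := by
        rw [h]
        monoidal

theorem coact₁_eq (A B : ComoduleMagma H) :
    coact₁ A B = (β_ A.X B.X).hom ≫ coact₂ B A ≫ (β_ B.X A.X).hom ▷ H.X := by
  have e2 : (β_ A.X B.X).hom ▷ H.X ≫ (β_ B.X A.X).hom ▷ H.X = 𝟙 _ := by
    rw [← comp_whiskerRight, SymmetricCategory.symmetry, id_whiskerRight]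
  unfold coact₁ coact₂
  rw [Category.assoc, ← BraidedCategory.braiding_naturality_left_assoc]
  simp [e2]

theorem coact₁_coassoc (A B : ComoduleMagma H) :
    coact₁ A B ≫ coact₁ A B ▷ H.X =
      coact₁ A B ≫ (A.X ⊗ B.X) ◁ Δ[H.X] ≫ (α_ (A.X ⊗ B.X) H.X H.X).inv := by
  have e2 : (β_ B.X A.X).hom ▷ H.X ≫ (β_ A.X B.X).hom ▷ H.X = 𝟙 _ := by
    rw [← comp_whiskerRight, SymmetricCategory.symmetry, id_whiskerRight]
  have h := coact₂_coassoc B A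
  rw [coact₁_eq]
  simp only [comp_whiskerRight, Category.assoc]
  rw [reassoc_of% e2, reassoc_of% h, ← whisker_exchange_assoc]
  simp

variable [HasEqualizers C]

/-- The underlying unital magma of `A • B`, on the equalizer of `ρ¹` and `ρ²`. -/
noncomputable abbrev prodMagma (A B : ComoduleMagma H) : UnitalMagma C :=
  UnitalMagma.eqMagma (coact₁_isHom A B) (coact₂_isHom A B)

/-- The inclusion `i : A • B ⟶ A ⊗ B`. -/
noncomputable abbrev incl (A B : ComoduleMagma H) : (prodMagma A B).X ⟶ A.X ⊗ B.X :=
  equalizer.ι (coact₁ A B) (coact₂ A B)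

theorem incl_condition (A B : ComoduleMagma H) :
    incl A B ≫ coact₁ A B = incl A B ≫ coact₂ A B :=
  equalizer.condition _ _

/-- If `H` is flat, then `i ⊗ H` is an equalizer of `ρ¹ ⊗ H` and `ρ² ⊗ H`. -/
noncomputable def inclIsLimit [Flat H.X] (A B : ComoduleMagma H) :
    IsLimit (Fork.ofι (f := coact₁ A B ▷ H.X) (g := coact₂ A B ▷ H.X) (incl A B ▷ H.X)
      (by rw [← comp_whiskerRight, ← comp_whiskerRight, incl_condition])) :=
  have := Flat.preserves_right H.X
  isLimitOfHasEqualizerOfPreservesLimit (tensorRight H.X) (coact₁ A B) (coact₂ A B)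

theorem incl_coact₂ (A B : ComoduleMagma H) :
    (incl A B ≫ coact₂ A B) ≫ coact₁ A B ▷ H.X =
      (incl A B ≫ coact₂ A B) ≫ coact₂ A B ▷ H.X := by
  have h := incl_condition A B
  rw [← incl_condition, Category.assoc, coact₁_coassoc, reassoc_of% h, h, Category.assoc,
    coact₂_coassoc]

theorem mono_incl_whiskerRight [Flat H.X] (A B : ComoduleMagma H) : Mono (incl A B ▷ H.X) :=
  mono_of_isLimit_fork (inclIsLimit A B)

theorem mono_incl_whiskerRight' [Flat H.X] (A B : ComoduleMagma H) :
    Mono (incl A B ▷ H.X ▷ H.X) := by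
  have := Flat.preserves_right H.X
  have := mono_incl_whiskerRight A B
  have : PreservesLimit (parallelPair (coact₁ A B ▷ H.X) (coact₂ A B ▷ H.X))
    (tensorRight H.X) := inferInstance
  exact mono_of_isLimit_fork (isLimitForkMapOfIsLimit (tensorRight H.X) _ (inclIsLimit A B))

/-- The coaction of `A • B`: the factorization of `ρ² ∘ i` through `i ⊗ H`. -/
noncomputable def prodCoact [Flat H.X] (A B : ComoduleMagma H) :
    (prodMagma A B).X ⟶ (prodMagma A B).X ⊗ H.X :=
  Fork.IsLimit.lift (inclIsLimit A B) (incl A B ≫ coact₂ A B) (incl_coact₂ A B)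

theorem prodCoact_incl [Flat H.X] (A B : ComoduleMagma H) :
    prodCoact A B ≫ incl A B ▷ H.X = incl A B ≫ coact₂ A B :=
  Fork.IsLimit.lift_ι' (inclIsLimit A B) _ _

/-- The product `A • B` of comodule magmas over a flat Hopf quasigroup. -/
noncomputable def prod [Flat H.X] (A B : ComoduleMagma H) : ComoduleMagma H where
  toUnitalMagma := prodMagma A B
  coact := prodCoact A B
  coact_coassoc := by
    have h := prodCoact_incl A B
    have h' : prodCoact A B ▷ H.X ≫ incl A B ▷ H.X ▷ H.X = incl A B ▷ H.X ≫ coact₂ A B ▷ H.X := by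
      rw [← comp_whiskerRight, h, comp_whiskerRight]
    have := mono_incl_whiskerRight' A B
    rw [← cancel_mono (incl A B ▷ H.X ▷ H.X), Category.assoc, h', reassoc_of% h, coact₂_coassoc]
    simp only [Category.assoc]
    rw [← associator_inv_naturality_left, whisker_exchange_assoc, reassoc_of% h]
  coact_counit := by
    have h := prodCoact_incl A B
    have hm : Mono (incl A B ▷ 𝟙_ C) := by
      rw [show incl A B ▷ 𝟙_ C = (ρ_ _).hom ≫ incl A B ≫ (ρ_ _).inv by simp]
      infer_instance
    rw [← cancel_mono (incl A B ▷ 𝟙_ C), Category.assoc, whisker_exchange, reassoc_of% h,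
      coact₂_counit, rightUnitor_inv_naturality]
  coact_isHom := by
    have := mono_incl_whiskerRight A B
    have hi : UnitalMagma.IsHom (prodMagma A B) (A.toUnitalMagma.tensor B.toUnitalMagma)
        (incl A B) :=
      UnitalMagma.eqMagma_ι (coact₁_isHom A B) (coact₂_isHom A B)
    refine UnitalMagma.IsHom.of_mono (hi.whiskerRight H.toUnitalMagma) ?_
    rw [prodCoact_incl]
    exact hi.comp (coact₂_isHom A B)

end ComoduleMagma

end ComoduleMagma

section Galois

variable {C : Type u} [Category.{v} C] [MonoidalCategory C] [SymmetricCategory C]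
  {H : HopfQuasigroup C}

/-- The canonical morphism `γ_A = (μ_A ⊗ H) ∘ (A ⊗ ρ_A) : A ⊗ A ⟶ A ⊗ H`. -/
def ComoduleMagma.can (A : ComoduleMagma H) : A.X ⊗ A.X ⟶ A.X ⊗ H.X :=
  A.X ◁ A.coact ≫ (α_ A.X A.X H.X).inv ≫ A.mul ▷ H.X

/-- The morphism `f_A = γ_A⁻¹ ∘ (η_A ⊗ H) : H ⟶ A ⊗ A`, for invertible `γ_A`. -/
noncomputable def ComoduleMagma.translation (A : ComoduleMagma H) [IsIso A.can] :
    H.X ⟶ A.X ⊗ A.X :=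
  (λ_ H.X).inv ≫ A.one ▷ H.X ≫ inv A.can

/-- `A` is a Galois `H`-object: `A` is faithfully flat and the canonical morphism is invertible. -/
structure IsGalois (A : ComoduleMagma H) : Prop where
  faithfullyFlat : FaithfullyFlat A.X
  isIso_can : IsIso A.can

/-- `A` is a strong Galois `H`-object: it is Galois and `f_A` is a morphism of unital magmas
from `H` to `A^e`. -/
structure IsStrongGalois (A : ComoduleMagma H) : Prop extends IsGalois A where
  translation_isHom :
    UnitalMagma.IsHom H.toUnitalMagma A.toUnitalMagma.env A.translation

/-- The category of Galois `H`-objects, a full subcategory of the right `H`-comodule magmas. -/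
abbrev GaloisObj (H : HopfQuasigroup C) :=
  ObjectProperty.FullSubcategory (fun A : ComoduleMagma H => IsGalois A)

/-- The category of strong Galois `H`-objects, a full subcategory of the right
`H`-comodule magmas. -/
abbrev StrongGaloisObj (H : HopfQuasigroup C) :=
  ObjectProperty.FullSubcategory (fun A : ComoduleMagma H => IsStrongGalois A)

/-- The isomorphism classes of objects of a category. -/
abbrev IsoClasses (D : Type*) [Category D] := Quotient (isIsomorphicSetoid D)

/-- The isomorphism class of an object. -/
abbrev isoClass {D : Type*} [Category D] (X : D) : IsoClasses D :=
  Quotient.mk (isIsomorphicSetoid D) X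

end Galois

end GaloisHopf

open GaloisHopf

/-!
# The group of strong Galois objects of a cocommutative Hopf quasigroup

The product `P = A • B` is the equalizer `i : P ⟶ A ⊗ B` of two commuting coactions (`coactLeft` and
`coactRight`), and everything is reduced to properties of equalizers preserved or reflected by
(faithfully) flat objects. Products in a Galois object need not be associative, so that the usual
linearity arguments over `A` are not available. In their place stands the Galois morphism
`m ⊗ p ↦ m s(p)` of an arbitrary `s : P ⟶ M ⊗ K` (`UnitalMagma.galoisMap`), which is natural in unital
magmas and compatible with tensor products without any associativity.

*Products.* The Galois morphism of `A ⊗ B`, with values in `A ⊗ B ⊗ H ⊗ H`, is invertible. It carries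
the two coactions of `A ⊗ B` to those of `H ⊗ H`, whose equalizer is the coproduct of `H` by
cocommutativity. Comparison of equalizers gives `A ⊗ B ⊗ P ≅ A ⊗ B ⊗ H`
(`UnitalMagma.isIso_galoisMap_coactRight`), so `P` is faithfully flat by descent. Since `P ⊗ P` and
`P ⊗ H` are equalizers of morphisms from `A ⊗ B ⊗ P` and `A ⊗ B ⊗ H`, a second comparison shows that
the canonical morphism of `P` is invertible (`UnitalMagma.isIso_galoisMap_of_isEqualizer`). The
universal property of `P` then yields commutativity, associativity and the unit: both iterated
products are the part of `A ⊗ B ⊗ D` on which three coactions agree, and the coaction of `A` is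
itself an equalizer of the coactions on `A ⊗ H` (`IsCoaction.isEqualizer`).

*Opposites.* The antipode axioms make the shear `x ⊗ h ↦ x₀ ⊗ h x₁` invertible for every coaction.
The canonical morphism of `A` factors through it as
`a b₀ ⊗ b₁ = (a₀ b)₀ ⊗ λ(a₁) (a₀ b)₁` (`ComoduleMagma.can_eq_canLeft`); hence `a ⊗ b ↦ a₀ b ⊗ a₁`, and with
it the canonical morphism of the opposite of `A`, is invertible as well.

*Inverses.* Faithful flatness and the canonical morphism reduce the coinvariants of a Galois
object to those of `H`, which are trivial (`ComoduleMagma.isEqualizer_one`). If the coactions of the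
opposite of `A` and of `A` agree on `x`, then `can x` is coinvariant in its first factor
(`ComoduleMagma.can_coact`), so `x` comes from `H` along the translation morphism. Thus the translation
morphism `H ⟶ A ⊗ A` is the equalizer defining the product of the opposite of `A` with `A`, and it
respects the coactions. For strong `A` it also respects units and products and gives
`H ≅ A.op • A` (`ComoduleMagma.op_prod`). That strength is inherited by products and opposites
follows from explicit formulas for their translation morphisms (`UnitalMagma.translation_tensor`,
`ComoduleMagma.translation_op`).
-/

namespace GaloisHopf

open scoped ComonObj

/-! ### Equalizers and faithful flatness -/

/-- The morphism `i` is an equalizer of `f` and `g`. -/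
structure IsEqualizer {C : Type u} [Category.{v} C] {E X Y : C} (i : E ⟶ X) (f g : X ⟶ Y) :
    Prop where
  condition : i ≫ f = i ≫ g
  isLimit : Nonempty (IsLimit (Fork.ofι i condition))

namespace IsEqualizer

section Basic

variable {C : Type u} [Category.{v} C] {E X Y : C} {i : E ⟶ X} {f g : X ⟶ Y}

theorem mono (h : IsEqualizer i f g) : Mono i :=
  mono_of_isLimit_fork h.isLimit.some

theorem exists_lift (h : IsEqualizer i f g) {T : C} (x : T ⟶ X) (hx : x ≫ f = x ≫ g) :
    ∃ y : T ⟶ E, y ≫ i = x :=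
  ⟨Fork.IsLimit.lift h.isLimit.some x hx, Fork.IsLimit.lift_ι' h.isLimit.some x hx⟩

theorem of_exists_lift (w : i ≫ f = i ≫ g) (hi : Mono i)
    (hl : ∀ {T : C} (x : T ⟶ X), x ≫ f = x ≫ g → ∃ y : T ⟶ E, y ≫ i = x) :
    IsEqualizer i f g :=
  ⟨w, ⟨Fork.IsLimit.mk' _ fun s =>
    ⟨(hl s.ι s.condition).choose, (hl s.ι s.condition).choose_spec, fun {m} hm => by
      rw [← cancel_mono i]
      exact hm.trans (hl s.ι s.condition).choose_spec.symm⟩⟩⟩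

theorem equalizer_ι (f g : X ⟶ Y) [HasEqualizer f g] : IsEqualizer (equalizer.ι f g) f g :=
  ⟨equalizer.condition f g, ⟨equalizerIsEqualizer f g⟩⟩

variable {E' X' Y' : C} {i' : E' ⟶ X'} {f' g' : X' ⟶ Y'}

/-- A morphism between two equalizers which is compatible with an isomorphism `q` of the ambient
objects and a monomorphism `r` of the codomains is an isomorphism. -/
theorem isIso (h : IsEqualizer i f g) (h' : IsEqualizer i' f' g') {p : E ⟶ E'} (q : X ⟶ X')
    [IsIso q] (r : Y ⟶ Y') [Mono r] (hi : p ≫ i' = i ≫ q) (hf : f ≫ r = q ≫ f')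
    (hg : g ≫ r = q ≫ g') : IsIso p := by
  obtain ⟨y, hy⟩ := h.exists_lift (i' ≫ inv q) (by
    rw [← cancel_mono r]
    simp only [Category.assoc, hf, hg, IsIso.inv_hom_id_assoc, h'.condition])
  have := h.mono
  have := h'.mono
  refine ⟨y, ?_, ?_⟩
  · rw [← cancel_mono i, Category.assoc, hy, reassoc_of% hi]
    simp
  · rw [← cancel_mono i', Category.assoc, hi, reassoc_of% hy]
    simp

/-- Equalizers are transported along isomorphisms of the three objects; on the codomains a
monomorphism is enough. -/
theorem of_iso (h : IsEqualizer i f g) (p : E ⟶ E') [IsIso p] (q : X ⟶ X') [IsIso q]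
    (r : Y ⟶ Y') [Mono r] (hi : p ≫ i' = i ≫ q) (hf : f ≫ r = q ≫ f') (hg : g ≫ r = q ≫ g') :
    IsEqualizer i' f' g' := by
  have hi' : i' = inv p ≫ i ≫ q := by rw [← hi, IsIso.inv_hom_id_assoc]
  have := h.mono
  refine of_exists_lift ?_ (hi' ▸ inferInstance) fun x hx => ?_
  · simp only [hi', Category.assoc, ← hf, ← hg, reassoc_of% h.condition]
  · obtain ⟨y, hy⟩ := h.exists_lift (x ≫ inv q) (by
      rw [← cancel_mono r]
      simpa only [Category.assoc, hf, hg, IsIso.inv_hom_id_assoc] using hx)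
    exact ⟨y ≫ p, by simp [hi, reassoc_of% hy]⟩

/-- Postcomposition of the parallel pair with a monomorphism does not change its equalizer. -/
theorem comp_mono (h : IsEqualizer i f g) (r : Y ⟶ Y') [Mono r] :
    IsEqualizer i (f ≫ r) (g ≫ r) :=
  h.of_iso (𝟙 _) (𝟙 _) r (by simp) (by simp) (by simp)

end Basic

section Monoidal

variable {C : Type u} [Category.{v} C] [MonoidalCategory C] {E X Y : C} {i : E ⟶ X} {f g : X ⟶ Y}

theorem whiskerLeft (h : IsEqualizer i f g) (A : C) [hA : Flat A] :
    IsEqualizer (A ◁ i) (A ◁ f) (A ◁ g) := by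
  have := hA.preservesEqualizers
  refine ⟨by simp only [← MonoidalCategory.whiskerLeft_comp, h.condition], ?_⟩
  exact ⟨isLimitForkMapOfIsLimit (tensorLeft A) h.condition h.isLimit.some⟩

theorem whiskerRight [SymmetricCategory C] (h : IsEqualizer i f g) (A : C) [Flat A] :
    IsEqualizer (i ▷ A) (f ▷ A) (g ▷ A) := by
  have := Flat.preserves_right A
  refine ⟨by simp only [← comp_whiskerRight, h.condition], ?_⟩
  exact ⟨isLimitForkMapOfIsLimit (tensorRight A) h.condition h.isLimit.some⟩

/-- Tensoring with a faithfully flat object reflects equalizers, including the equality of the two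
composites with the parallel pair. -/
theorem of_whiskerLeft [HasEqualizers C] (A : C) [hA : FaithfullyFlat A]
    (h : IsEqualizer (A ◁ i) (A ◁ f) (A ◁ g)) : IsEqualizer i f g := by
  have := hA.preservesEqualizers
  have := hA.reflectsIsos
  have w : i ≫ f = i ≫ g := by
    -- the comparison of the equalizer of `i ≫ f` and `i ≫ g` with `E` is an isomorphism
    have h1 := (equalizer_ι (i ≫ f) (i ≫ g)).whiskerLeft A
    obtain ⟨y, hy⟩ := h1.exists_lift (𝟙 _) (by simpa using h.condition)
    have := h1.mono
    have h2 : IsIso (A ◁ equalizer.ι (i ≫ f) (i ≫ g)) := ⟨y, by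
      rw [← cancel_mono (A ◁ equalizer.ι (i ≫ f) (i ≫ g))]
      simp [hy], hy⟩
    have h3 : IsIso (equalizer.ι (i ≫ f) (i ≫ g)) := by
      have : IsIso ((tensorLeft A).map (equalizer.ι (i ≫ f) (i ≫ g))) := h2
      exact isIso_of_reflects_iso _ (tensorLeft A)
    rw [← cancel_epi (equalizer.ι (i ≫ f) (i ≫ g)), equalizer.condition]
  have : ReflectsLimit (parallelPair f g) (tensorLeft A) :=
    reflectsLimit_of_reflectsIsomorphisms _ _
  exact ⟨w, ⟨isLimitOfIsLimitForkMap (tensorLeft A) w h.isLimit.some⟩⟩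

end Monoidal

end IsEqualizer

section FaithfullyFlat

variable {C : Type u} [Category.{v} C] [MonoidalCategory C]

theorem FaithfullyFlat.of_iso {A B : C} (e : A ≅ B) (hA : FaithfullyFlat A) :
    FaithfullyFlat B := by
  have := hA.preservesEqualizers
  have := hA.reflectsIsos
  let E : tensorLeft A ≅ tensorLeft B := (tensoringLeft C).mapIso e
  exact { preservesEqualizers := preservesLimitsOfShape_of_natIso E
          reflectsIsos := reflectsIsomorphisms_of_iso E }

theorem FaithfullyFlat.tensor {A B : C} (hA : FaithfullyFlat A) (hB : FaithfullyFlat B) :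
    FaithfullyFlat (A ⊗ B) := by
  have := hA.preservesEqualizers
  have := hA.reflectsIsos
  have := hB.preservesEqualizers
  have := hB.reflectsIsos
  exact { preservesEqualizers := preservesLimitsOfShape_of_natIso (tensorLeftTensor A B).symm
          reflectsIsos := reflectsIsomorphisms_of_iso (tensorLeftTensor A B).symm }

/-- Faithful flatness descends along a faithfully flat object. -/
theorem FaithfullyFlat.of_tensor {A B : C} (hA : FaithfullyFlat A)
    (hAB : FaithfullyFlat (A ⊗ B)) [HasEqualizers C] : FaithfullyFlat B := by
  have := hA.preservesEqualizers
  have := hA.reflectsIsos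
  have := hAB.preservesEqualizers
  have := hAB.reflectsIsos
  have h1 : PreservesLimitsOfShape WalkingParallelPair (tensorLeft B ⋙ tensorLeft A) :=
    preservesLimitsOfShape_of_natIso (tensorLeftTensor A B)
  have h2 : (tensorLeft B ⋙ tensorLeft A).ReflectsIsomorphisms :=
    reflectsIsomorphisms_of_iso (tensorLeftTensor A B)
  have h3 : ReflectsLimitsOfShape WalkingParallelPair (tensorLeft A) :=
    reflectsLimitsOfShape_of_reflectsIsomorphisms
  exact { preservesEqualizers :=
            preservesLimitsOfShape_of_reflects_of_preserves (tensorLeft B) (tensorLeft A)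
          reflectsIsos := reflectsIsomorphisms_of_comp (tensorLeft B) (tensorLeft A) }

end FaithfullyFlat

/-! ### Interchange of tensor factors -/

section Interchange

variable {C : Type u} [Category.{v} C] [MonoidalCategory C] [SymmetricCategory C]

@[simp]
theorem tensorμ_tensorμ (W X Y Z : C) : tensorμ W X Y Z ≫ tensorμ W Y X Z = 𝟙 _ := by
  have h : tensorδ W X Y Z = tensorμ W Y X Z := by
    simp only [tensorδ, tensorμ, SymmetricCategory.braiding_swap_eq_inv_braiding X Y]
  rw [← h, tensorμ_tensorδ]

@[simp]
theorem tensorμ_tensorμ_assoc {W X Y Z T : C} (f : (W ⊗ X) ⊗ (Y ⊗ Z) ⟶ T) :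
    tensorμ W X Y Z ≫ tensorμ W Y X Z ≫ f = f := by
  rw [← Category.assoc, tensorμ_tensorμ, Category.id_comp]

instance (W X Y Z : C) : IsIso (tensorμ W X Y Z) :=
  ⟨tensorμ W Y X Z, tensorμ_tensorμ .., tensorμ_tensorμ ..⟩

theorem braiding_tensorμ (X Y Z W : C) :
    (β_ (X ⊗ Y) (Z ⊗ W)).hom ≫ tensorμ Z W X Y =
      tensorμ X Y Z W ≫ ((β_ X Z).hom ⊗ₘ (β_ Y W).hom) := by
  have h : Z ◁ (β_ X W).hom ▷ Y ≫ Z ◁ (β_ W X).hom ▷ Y = 𝟙 _ := by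
    rw [← MonoidalCategory.whiskerLeft_comp, ← comp_whiskerRight, SymmetricCategory.symmetry,
      id_whiskerRight, MonoidalCategory.whiskerLeft_id]
  simp only [tensorμ, Category.assoc, BraidedCategory.braiding_tensor_right_hom,
    BraidedCategory.braiding_tensor_left_hom, comp_whiskerRight, whisker_assoc,
    MonoidalCategory.whiskerLeft_comp, pentagon_assoc, pentagon_inv_hom_hom_hom_inv_assoc,
    Iso.inv_hom_id_assoc, whiskerLeft_hom_inv_assoc, reassoc_of% h,
    MonoidalCategory.tensorHom_def]
  monoidal

end Interchange

/-! ### Galois morphisms -/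

namespace UnitalMagma

section Basic

variable {C : Type u} [Category.{v} C] [MonoidalCategory C]

/-- The Galois morphism `(μ ⊗ K) ∘ (M ⊗ s) : M ⊗ P ⟶ M ⊗ K` of `s : P ⟶ M ⊗ K`. For the coaction
of a comodule magma this is the canonical morphism `γ`. -/
def galoisMap (M : UnitalMagma C) {P K : C} (s : P ⟶ M.X ⊗ K) : M.X ⊗ P ⟶ M.X ⊗ K :=
  M.X ◁ s ≫ (α_ M.X M.X K).inv ≫ M.mul ▷ K

variable (M : UnitalMagma C) {P P' K K' : C}

theorem galoisMap_comp_whiskerLeft (s : P ⟶ M.X ⊗ K) (k : K ⟶ K') :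
    M.galoisMap s ≫ M.X ◁ k = M.galoisMap (s ≫ M.X ◁ k) := by
  simp [galoisMap, ← whisker_exchange]

theorem whiskerLeft_comp_galoisMap (p : P ⟶ P') (s : P' ⟶ M.X ⊗ K) :
    M.X ◁ p ≫ M.galoisMap s = M.galoisMap (p ≫ s) := by
  simp [galoisMap]

theorem galoisMap_whiskerRight (s : P ⟶ M.X ⊗ K) (L : C) :
    M.galoisMap s ▷ L =
      (α_ M.X P L).hom ≫ M.galoisMap (s ▷ L ≫ (α_ M.X K L).hom) ≫ (α_ M.X K L).inv := by
  simp only [galoisMap]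
  monoidal

/-- The Galois morphism is natural with respect to morphisms of unital magmas. -/
theorem IsHom.galoisMap {M N : UnitalMagma C} {f : M.X ⟶ N.X} (hf : IsHom M N f) {P P' K K' : C}
    (s : P ⟶ M.X ⊗ K) (t : P' ⟶ N.X ⊗ K') (p : P ⟶ P') (k : K ⟶ K')
    (h : s ≫ (f ⊗ₘ k) = p ≫ t) : M.galoisMap s ≫ (f ⊗ₘ k) = (f ⊗ₘ p) ≫ N.galoisMap t := by
  have h1 : M.mul ▷ K ≫ (f ⊗ₘ k) = ((f ⊗ₘ f) ⊗ₘ k) ≫ N.mul ▷ K' := by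
    rw [← tensorHom_id, ← tensorHom_id, tensorHom_comp_tensorHom, tensorHom_comp_tensorHom,
      hf.mul_hom]
    simp
  have h2 : M.X ◁ s ≫ (f ⊗ₘ (f ⊗ₘ k)) = (f ⊗ₘ p) ≫ N.X ◁ t := by
    rw [← id_tensorHom, ← id_tensorHom, tensorHom_comp_tensorHom, tensorHom_comp_tensorHom, h]
    simp
  simp only [UnitalMagma.galoisMap, Category.assoc]
  rw [h1, ← associator_inv_naturality_assoc, reassoc_of% h2]

end Basic

section Tensor

variable {C : Type u} [Category.{v} C] [MonoidalCategory C] [SymmetricCategory C]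

/-- The Galois morphism of a tensor product of unital magmas is the tensor product of the Galois
morphisms, up to interchange. -/
theorem galoisMap_tensor (A B : UnitalMagma C) {P Q K L : C} (s : P ⟶ A.X ⊗ K)
    (t : Q ⟶ B.X ⊗ L) :
    (A.tensor B).galoisMap ((s ⊗ₘ t) ≫ tensorμ A.X K B.X L) =
      tensorμ A.X B.X P Q ≫ (A.galoisMap s ⊗ₘ B.galoisMap t) ≫ tensorμ A.X K B.X L := by
  have h := tensor_associativity A.X B.X A.X B.X K L
  have h' : (α_ (A.X ⊗ B.X) (A.X ⊗ B.X) (K ⊗ L)).inv ≫ tensorμ A.X B.X A.X B.X ▷ (K ⊗ L) =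
      (A.X ⊗ B.X) ◁ tensorμ A.X B.X K L ≫ tensorμ A.X B.X (A.X ⊗ K) (B.X ⊗ L) ≫
        ((α_ _ _ _).inv ⊗ₘ (α_ _ _ _).inv) ≫ tensorμ (A.X ⊗ A.X) K (B.X ⊗ B.X) L := by
    rw [Iso.inv_comp_eq, ← reassoc_of% h, tensorHom_comp_tensorHom_assoc]
    simp
  have h1 : (A.X ⊗ B.X) ◁ tensorμ A.X K B.X L ≫ (A.X ⊗ B.X) ◁ tensorμ A.X B.X K L = 𝟙 _ := by
    rw [← MonoidalCategory.whiskerLeft_comp]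
    simp
  have h2 : (A.X ⊗ B.X) ◁ (s ⊗ₘ t) ≫ tensorμ A.X B.X (A.X ⊗ K) (B.X ⊗ L) =
      tensorμ A.X B.X P Q ≫ (A.X ◁ s ⊗ₘ B.X ◁ t) := tensorμ_natural_right ..
  have h3 : tensorμ (A.X ⊗ A.X) K (B.X ⊗ B.X) L ≫ (A.mul ⊗ₘ B.mul) ▷ (K ⊗ L) =
      (A.mul ▷ K ⊗ₘ B.mul ▷ L) ≫ tensorμ A.X K B.X L := by
    have := tensorμ_natural A.mul (𝟙 K) B.mul (𝟙 L)
    simpa using this.symm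
  simp only [galoisMap, comp_whiskerRight, MonoidalCategory.whiskerLeft_comp, Category.assoc]
  rw [reassoc_of% h', reassoc_of% h1, reassoc_of% h2, h3]
  simp only [← tensorHom_comp_tensorHom, Category.assoc]

theorem isIso_galoisMap_tensor (A B : UnitalMagma C) {P Q K L : C} (s : P ⟶ A.X ⊗ K)
    (t : Q ⟶ B.X ⊗ L) [IsIso (A.galoisMap s)] [IsIso (B.galoisMap t)] :
    IsIso ((A.tensor B).galoisMap ((s ⊗ₘ t) ≫ tensorμ A.X K B.X L)) := by
  rw [galoisMap_tensor]
  infer_instance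

/-- The interchange of the two middle factors is a morphism of unital magmas. -/
theorem isHom_tensorμ (A B D E : UnitalMagma C) :
    IsHom ((A.tensor B).tensor (D.tensor E)) ((A.tensor D).tensor (B.tensor E))
      (tensorμ A.X B.X D.X E.X) :=
  (isHom_associator A B (D.tensor E)).comp
    (((isHom_associator_inv B D E).whiskerLeft A).comp
      ((((isHom_braiding B D).whiskerRight E).whiskerLeft A).comp
        (((isHom_associator D B E).whiskerLeft A).comp (isHom_associator_inv A D (B.tensor E)))))

end Tensor

end UnitalMagma

/-! ### The two coactions on a tensor product -/

section Coaction

variable {C : Type u} [Category.{v} C] [MonoidalCategory C]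

/-- `r : X ⟶ X ⊗ K` is a coassociative and counital right coaction of the comonoid `K`. -/
structure IsCoaction {K : C} [ComonObj K] {X : C} (r : X ⟶ X ⊗ K) : Prop where
  coassoc : r ≫ r ▷ K = r ≫ X ◁ Δ[K] ≫ (α_ X K K).inv
  counit : r ≫ X ◁ ε[K] = (ρ_ X).inv

theorem isCoaction_comul (K : C) [ComonObj K] : IsCoaction Δ[K] := ⟨by simp, by simp⟩

/-- The coaction on `X ⊗ Y` by means of the second factor. -/
def coactRight (X : C) {K Y : C} (s : Y ⟶ Y ⊗ K) : X ⊗ Y ⟶ (X ⊗ Y) ⊗ K :=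
  X ◁ s ≫ (α_ X Y K).inv

theorem IsCoaction.coactRight (X : C) {K Y : C} [ComonObj K] {s : Y ⟶ Y ⊗ K} (hs : IsCoaction s) :
    IsCoaction (coactRight X s) := by
  refine ⟨?_, ?_⟩
  · calc _ = X ◁ (s ≫ s ▷ K) ≫ (α_ _ _ _).inv ≫ (α_ _ _ _).inv ▷ K := by
          simp only [GaloisHopf.coactRight]
          monoidal
      _ = _ := by
          rw [hs.coassoc]
          simp only [GaloisHopf.coactRight]
          monoidal
  · calc _ = X ◁ (s ≫ Y ◁ ε[K]) ≫ (α_ _ _ _).inv := by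
          simp only [GaloisHopf.coactRight]
          monoidal
      _ = _ := by
          rw [hs.counit]
          monoidal

/-- `X ⟶ Y ⊗ K`, `x ↦ m x₀ ⊗ x₁`, is colinear, for any morphism `m`. -/
theorem IsCoaction.coassoc_comp {X Y K : C} [ComonObj K] {r : X ⟶ X ⊗ K} (hr : IsCoaction r)
    (m : X ⟶ Y) : r ≫ (r ≫ m ▷ K) ▷ K = (r ≫ m ▷ K) ≫ Y ◁ Δ[K] ≫ (α_ _ _ _).inv := by
  have h := hr.coassoc
  rw [MonoidalCategory.comp_whiskerRight, reassoc_of% h, ← associator_inv_naturality_left,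
    whisker_exchange_assoc, Category.assoc]

variable [SymmetricCategory C]

theorem braiding_whiskerRight_symmetry (X Y Z : C) :
    (β_ X Y).hom ▷ Z ≫ (β_ Y X).hom ▷ Z = 𝟙 _ := by
  rw [← comp_whiskerRight, SymmetricCategory.symmetry, id_whiskerRight]

/-- The coaction on `X ⊗ Y` by means of the first factor. -/
def coactLeft {K X : C} (r : X ⟶ X ⊗ K) (Y : C) : X ⊗ Y ⟶ (X ⊗ Y) ⊗ K :=
  r ▷ Y ≫ (α_ X K Y).hom ≫ X ◁ (β_ K Y).hom ≫ (α_ X Y K).inv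

/-- The coaction of `K ⊗ L` on `X ⊗ Y` by means of both factors. -/
def coactBoth {K L X Y : C} (r : X ⟶ X ⊗ K) (s : Y ⟶ Y ⊗ L) : X ⊗ Y ⟶ (X ⊗ Y) ⊗ (K ⊗ L) :=
  (r ⊗ₘ s) ≫ tensorμ X K Y L

theorem coactLeft_comp_whiskerLeft {X K : C} (r : X ⟶ X ⊗ K) (k : K ⟶ K) (Y : C) :
    coactLeft (r ≫ X ◁ k) Y = coactLeft r Y ≫ (X ⊗ Y) ◁ k := by
  have h : k ▷ Y ≫ (β_ K Y).hom = (β_ K Y).hom ≫ Y ◁ k :=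
    BraidedCategory.braiding_naturality_left _ _
  simp only [coactLeft, comp_whiskerRight, Category.assoc, whisker_assoc, Iso.inv_hom_id_assoc,
    ← MonoidalCategory.whiskerLeft_comp_assoc, h]
  simp

variable {K X Y : C} (r : X ⟶ X ⊗ K) (s : Y ⟶ Y ⊗ K)

theorem coactLeft_eq : coactLeft r Y = (β_ X Y).hom ≫ coactRight Y r ≫ (β_ Y X).hom ▷ K := by
  unfold coactLeft coactRight
  rw [Category.assoc, ← BraidedCategory.braiding_naturality_left_assoc]
  simp [braiding_whiskerRight_symmetry]

theorem braiding_coactLeft :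
    (β_ Y X).hom ≫ coactLeft r Y = coactRight Y r ≫ (β_ Y X).hom ▷ K := by
  rw [coactLeft_eq]
  simp

theorem braiding_coactRight :
    (β_ X Y).hom ≫ coactRight Y r = coactLeft r Y ≫ (β_ X Y).hom ▷ K := by
  rw [coactLeft_eq]
  simp [braiding_whiskerRight_symmetry]

theorem IsCoaction.coactLeft [ComonObj K] {r : X ⟶ X ⊗ K} (hr : IsCoaction r) (Y : C) :
    IsCoaction (coactLeft r Y) := by
  have h := (hr.coactRight Y)
  have h1 := reassoc_of% h.coassoc
  have h2 := reassoc_of% h.counit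
  refine ⟨?_, ?_⟩
  · rw [coactLeft_eq]
    simp only [comp_whiskerRight, Category.assoc]
    rw [reassoc_of% braiding_whiskerRight_symmetry, h1, ← whisker_exchange_assoc]
    simp
  · rw [coactLeft_eq, Category.assoc, Category.assoc, ← whisker_exchange, h2]
    simp

theorem braiding_coactBoth :
    (β_ Y X).hom ≫ coactBoth r s = coactBoth s r ≫ ((β_ Y X).hom ⊗ₘ (β_ K K).hom) := by
  simp only [coactBoth, Category.assoc]
  rw [← braiding_tensorμ, BraidedCategory.braiding_naturality_assoc]

/-- The coaction by means of both factors is the iteration of the two single coactions; in the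
opposite order, the two factors `K` have to be interchanged. -/
theorem coactBoth_eq :
    coactBoth r s = coactRight X s ≫ coactLeft r Y ▷ K ≫ (α_ _ _ _).hom := by
  simp only [coactBoth, coactLeft, coactRight, tensorμ, MonoidalCategory.tensorHom_def']
  monoidal

theorem coactBoth_eq' :
    coactBoth r s =
      coactLeft r Y ≫ coactRight X s ▷ K ≫ (α_ _ _ _).hom ≫ (X ⊗ Y) ◁ (β_ K K).hom := by
  rw [← cancel_epi (β_ Y X).hom, braiding_coactBoth, coactBoth_eq s r,
    reassoc_of% braiding_coactLeft, ← comp_whiskerRight_assoc, braiding_coactRight]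
  simp [MonoidalCategory.tensorHom_def]

/-- The coactions by means of the two factors commute. -/
theorem coactLeft_coactRight :
    coactLeft r Y ≫ coactRight X s ▷ K = coactRight X s ≫ coactLeft r Y ▷ K ≫ (α_ _ _ _).hom ≫
      (X ⊗ Y) ◁ (β_ K K).hom ≫ (α_ _ _ _).inv := by
  have h := (coactBoth_eq' r s).symm.trans (coactBoth_eq r s)
  rw [← cancel_mono ((α_ _ _ _).hom ≫ (X ⊗ Y) ◁ (β_ K K).hom)]
  simp only [Category.assoc, h, Iso.inv_hom_id_assoc, ← MonoidalCategory.whiskerLeft_comp,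
    SymmetricCategory.symmetry, MonoidalCategory.whiskerLeft_id, Category.comp_id]

variable {r s}

/-- `coactBoth` intertwines the second coaction on `X ⊗ Y` with that on `K ⊗ K`. -/
theorem coactRight_coactBoth [ComonObj K] (hs : IsCoaction s) :
    coactRight X s ≫ coactBoth r s ▷ K ≫ (α_ _ _ _).hom =
      coactBoth r s ≫ (X ⊗ Y) ◁ coactRight K Δ[K] := by
  have h := hs.coassoc
  calc _ = (r ⊗ₘ (s ≫ s ▷ K)) ≫ (α_ _ _ _).inv ≫ tensorμ X K Y K ▷ K ≫ (α_ _ _ _).hom := by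
        simp only [coactBoth, coactRight, MonoidalCategory.tensorHom_def']
        monoidal
    _ = (r ⊗ₘ s) ≫ (X ⊗ K) ◁ (Y ◁ Δ[K]) ≫ (X ⊗ K) ◁ (α_ _ _ _).inv ≫
        (α_ _ _ _).inv ≫ tensorμ X K Y K ▷ K ≫ (α_ _ _ _).hom := by
        rw [h]
        simp only [MonoidalCategory.tensorHom_def]
        monoidal
    _ = (r ⊗ₘ s) ≫ (X ⊗ K) ◁ (Y ◁ Δ[K]) ≫ tensorμ X K Y (K ⊗ K) ≫
          (X ⊗ Y) ◁ (α_ K K K).inv := by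
        simp only [tensorμ]
        monoidal
    _ = _ := by
        have h3 := tensorμ_natural (𝟙 X) (𝟙 K) (𝟙 Y) Δ[K]
        simp only [id_whiskerRight, tensorHom_id, id_tensorHom] at h3
        rw [reassoc_of% h3]
        simp [coactBoth, coactRight]

/-- `coactBoth` intertwines the first coaction on `X ⊗ Y` with that on `K ⊗ K`. -/
theorem coactLeft_coactBoth [ComonObj K] (hr : IsCoaction r) :
    coactLeft r Y ≫ coactBoth r s ▷ K ≫ (α_ _ _ _).hom =
      coactBoth r s ≫ (X ⊗ Y) ◁ coactLeft Δ[K] K := by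
  have h := coactRight_coactBoth (r := s) hr
  rw [← cancel_epi (β_ Y X).hom, reassoc_of% braiding_coactLeft, reassoc_of% braiding_coactBoth,
    ← comp_whiskerRight_assoc, braiding_coactBoth]
  calc _ = (coactRight Y r ≫ coactBoth s r ▷ K ≫ (α_ _ _ _).hom) ≫
        ((β_ Y X).hom ⊗ₘ (β_ K K).hom ▷ K) := by
        simp only [MonoidalCategory.tensorHom_def]
        monoidal
    _ = _ := by
        rw [h]
        simp only [MonoidalCategory.tensorHom_def, Category.assoc,
          ← MonoidalCategory.whiskerLeft_comp, braiding_coactLeft]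
        simp only [MonoidalCategory.whiskerLeft_comp, whisker_exchange_assoc]

/-- On a subobject on which the two coactions on `X ⊗ Y` agree, the coaction by means of both
factors is the common coaction followed by the coproduct. -/
theorem equalizing_coactBoth [ComonObj K] (hr : IsCoaction r) {P : C} {i : P ⟶ X ⊗ Y}
    (hi : i ≫ coactLeft r Y = i ≫ coactRight X s) :
    (i ≫ coactRight X s) ≫ (X ⊗ Y) ◁ Δ[K] = i ≫ coactBoth r s := by
  have h := (hr.coactLeft Y).coassoc
  rw [coactBoth_eq, ← reassoc_of% hi, reassoc_of% h, ← hi]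
  simp

/-- A coaction of a cocommutative comonoid `K` is the equalizer of the two coactions on `X ⊗ K`. -/
theorem IsCoaction.isEqualizer [ComonObj K] [IsCommComonObj K] (hr : IsCoaction r) :
    IsEqualizer r (GaloisHopf.coactLeft r K) (GaloisHopf.coactRight X Δ[K]) := by
  refine .of_exists_lift ?_ ?_ fun {T} x hx => ?_
  · have h := hr.coassoc
    simp only [GaloisHopf.coactLeft, GaloisHopf.coactRight]
    rw [reassoc_of% h]
    simp only [Iso.inv_hom_id_assoc, ← MonoidalCategory.whiskerLeft_comp_assoc,
      IsCommComonObj.comul_comm]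
  · have : Mono (r ≫ X ◁ ε[K]) := by
      rw [hr.counit]
      infer_instance
    exact mono_of_mono r (X ◁ ε[K])
  · refine ⟨x ≫ X ◁ ε[K] ≫ (ρ_ _).hom, ?_⟩
    have h1 : GaloisHopf.coactLeft r K ≫ (X ◁ ε[K]) ▷ K ≫ (ρ_ X).hom ▷ K =
        X ◁ ε[K] ≫ (ρ_ _).hom ≫ r := by
      have e : (β_ K K).hom ≫ ε[K] ▷ K = K ◁ ε[K] ≫ (β_ _ _).hom :=
        (BraidedCategory.braiding_naturality_right _ _).symm
      calc _ = r ▷ K ≫ (α_ _ _ _).hom ≫ X ◁ ((β_ K K).hom ≫ ε[K] ▷ K) ≫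
            (α_ _ _ _).inv ≫ (ρ_ X).hom ▷ K := by
            simp only [GaloisHopf.coactLeft]
            monoidal
        _ = (r ▷ K ≫ (X ⊗ K) ◁ ε[K]) ≫ (α_ _ _ _).hom ≫ X ◁ (β_ K (𝟙_ C)).hom ≫
            (α_ _ _ _).inv ≫ (ρ_ X).hom ▷ K := by
            rw [e]
            monoidal
        _ = _ := by
            rw [← whisker_exchange, braiding_tensorUnit_right]
            monoidal
    have h2 : GaloisHopf.coactRight X Δ[K] ≫ (X ◁ ε[K]) ▷ K ≫ (ρ_ X).hom ▷ K = 𝟙 _ := by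
      calc _ = X ◁ (Δ[K] ≫ ε[K] ▷ K) ≫ (α_ _ _ _).inv ≫ (ρ_ X).hom ▷ K := by
            simp only [GaloisHopf.coactRight]
            monoidal
        _ = _ := by
            rw [ComonObj.counit_comul]
            monoidal
    rw [Category.assoc, Category.assoc, ← h1, reassoc_of% hx, h2, Category.comp_id]

end Coaction

/-! ### Galois morphisms of equalizers of coactions -/

namespace UnitalMagma

section Basic

variable {C : Type u} [Category.{v} C] [MonoidalCategory C] (M : UnitalMagma C) {P K : C}

theorem galoisMap_whiskerRight_eq (s : P ⟶ M.X ⊗ K) (L : C) :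
    M.galoisMap (s ▷ L ≫ (α_ M.X K L).hom) =
      (α_ M.X P L).inv ≫ M.galoisMap s ▷ L ≫ (α_ M.X K L).hom := by
  simp [galoisMap_whiskerRight]

end Basic

variable {C : Type u} [Category.{v} C] [MonoidalCategory C] [SymmetricCategory C]
  {M N : UnitalMagma C}

/-- If `s : P ⟶ M ⊗ N` is colinear and the Galois morphisms of `s` and of the coproduct of `N`
are invertible, then `m ⊗ n ⊗ p ↦ m p₀ ⊗ n p₁ ⊗ p₂` is a monomorphism. -/
theorem mono_galoisMap_tensor [ComonObj N.X] [IsCommComonObj N.X] [IsIso (N.galoisMap Δ[N.X])]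
    {P : C} {r : P ⟶ P ⊗ N.X} (hr : IsCoaction r) (s : P ⟶ M.X ⊗ N.X) [IsIso (M.galoisMap s)]
    (hs : r ≫ s ▷ N.X = s ≫ M.X ◁ Δ[N.X] ≫ (α_ M.X N.X N.X).inv) :
    Mono ((M.tensor N).galoisMap (s ≫ M.X ◁ Δ[N.X] ≫ (α_ M.X N.X N.X).inv)) := by
  have h1 : (s ≫ M.X ◁ Δ[N.X] ≫ (α_ M.X N.X N.X).inv) ≫ (M.X ⊗ N.X) ◁ Δ[N.X] =
      r ≫ (s ⊗ₘ Δ[N.X]) ≫ tensorμ M.X N.X N.X N.X := by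
    have e : Δ[N.X] ≫ N.X ◁ Δ[N.X] ≫ (α_ _ _ _).inv = Δ[N.X] ≫ Δ[N.X] ▷ N.X := by simp
    have e' : (Δ[N.X] ≫ N.X ◁ Δ[N.X] ≫ (α_ _ _ _).inv) ≫ (β_ N.X N.X).hom ▷ N.X =
        Δ[N.X] ≫ N.X ◁ Δ[N.X] ≫ (α_ _ _ _).inv := by
      rw [e, Category.assoc, ← comp_whiskerRight, IsCommComonObj.comul_comm]
    simp only [MonoidalCategory.tensorHom_def, Category.assoc]
    rw [reassoc_of% hs]
    calc _ = s ≫ M.X ◁ (Δ[N.X] ≫ N.X ◁ Δ[N.X] ≫ (α_ _ _ _).inv) ≫ M.X ◁ (α_ _ _ _).hom ≫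
          (α_ _ _ _).inv := by monoidal
      _ = _ := by
        rw [← e']
        simp only [tensorμ]
        monoidal
  have h2 : Mono ((M.tensor N).X ◁ r) := by
    have : Mono ((M.tensor N).X ◁ r ≫ (M.tensor N).X ◁ (P ◁ ε[N.X])) := by
      rw [← MonoidalCategory.whiskerLeft_comp, hr.counit]
      infer_instance
    exact mono_of_mono _ ((M.tensor N).X ◁ (P ◁ ε[N.X]))
  have h3 := isIso_galoisMap_tensor M N s Δ[N.X]
  have h4 : Mono ((M.tensor N).galoisMap (s ≫ M.X ◁ Δ[N.X] ≫ (α_ M.X N.X N.X).inv) ≫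
      (M.tensor N).X ◁ Δ[N.X]) := by
    rw [galoisMap_comp_whiskerLeft, h1, ← whiskerLeft_comp_galoisMap]
    infer_instance
  exact mono_of_mono _ ((M.tensor N).X ◁ Δ[N.X])

/-- Let `P` be the equalizer, in unital magmas, of two coactions on `M`, so that each of them
restricts to the coaction `r` of `P`. If `m ⊗ p ↦ m p₀ ⊗ p₁` is an isomorphism
`M ⊗ P ⟶ M ⊗ N`, then so is the Galois morphism `P ⊗ P ⟶ P ⊗ N` of `P`. -/
theorem isIso_galoisMap_of_isEqualizer [ComonObj N.X] [IsCommComonObj N.X]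
    [IsIso (N.galoisMap Δ[N.X])] {P : UnitalMagma C} [Flat P.X] [Flat N.X]
    {r : P.X ⟶ P.X ⊗ N.X} (hr : IsCoaction r) {i : P.X ⟶ M.X} (hi : IsHom P M i)
    {r₁ r₂ : M.X ⟶ M.X ⊗ N.X} (h₁ : IsHom M (M.tensor N) r₁) (h₂ : IsHom M (M.tensor N) r₂)
    (he : IsEqualizer i r₁ r₂) (hir : r ≫ i ▷ N.X = i ≫ r₂) [IsIso (M.galoisMap (i ≫ r₂))] :
    IsIso (P.galoisMap r) := by
  have hs : r ≫ (i ≫ r₂) ▷ N.X = (i ≫ r₂) ≫ M.X ◁ Δ[N.X] ≫ (α_ _ _ _).inv := by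
    have h := hr.coassoc
    rw [← hir, comp_whiskerRight, reassoc_of% h, ← associator_inv_naturality_left,
      whisker_exchange_assoc, Category.assoc]
  have hm := mono_galoisMap_tensor hr (i ≫ r₂) hs
  have k₂ : (i ≫ r₂) ≫ (r₂ ⊗ₘ 𝟙 N.X) =
      𝟙 _ ≫ (i ≫ r₂) ≫ M.X ◁ Δ[N.X] ≫ (α_ _ _ _).inv := by
    rw [Category.id_comp, ← hs, ← hir, tensorHom_id, Category.assoc, ← comp_whiskerRight, hir]
  have k₁ : (i ≫ r₂) ≫ (r₁ ⊗ₘ 𝟙 N.X) =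
      𝟙 _ ≫ (i ≫ r₂) ≫ M.X ◁ Δ[N.X] ≫ (α_ _ _ _).inv := by
    rw [← k₂, ← hir, tensorHom_id, tensorHom_id, Category.assoc, Category.assoc,
      ← comp_whiskerRight, ← comp_whiskerRight, he.condition]
  refine (he.whiskerRight P.X).isIso (he.whiskerRight N.X) (M.galoisMap (i ≫ r₂))
    ((M.tensor N).galoisMap ((i ≫ r₂) ≫ M.X ◁ Δ[N.X] ≫ (α_ _ _ _).inv)) ?_ ?_ ?_
  · have := hi.galoisMap r (i ≫ r₂) (𝟙 _) (𝟙 _) (by simpa using hir)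
    simpa using this
  · have := h₁.galoisMap _ _ _ _ k₁
    simpa using this.symm
  · have := h₂.galoisMap _ _ _ _ k₂
    simpa using this.symm

/-- If `i : P ⟶ A ⊗ B` is the equalizer of the two coactions and the Galois morphisms of `A` and
`B` are invertible, then `a ⊗ b ⊗ p ↦ (a ⊗ b) p₀ ⊗ p₁` is an isomorphism
`(A ⊗ B) ⊗ P ⟶ (A ⊗ B) ⊗ K`. -/
theorem isIso_galoisMap_coactRight {A B : UnitalMagma C} {K : C} [ComonObj K] [IsCommComonObj K]
    [Flat (A.X ⊗ B.X)] {r : A.X ⟶ A.X ⊗ K} {s : B.X ⟶ B.X ⊗ K} (hr : IsCoaction r)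
    (hs : IsCoaction s) [IsIso (A.galoisMap r)] [IsIso (B.galoisMap s)] {P : C}
    {i : P ⟶ A.X ⊗ B.X} (hi : IsEqualizer i (coactLeft r B.X) (coactRight A.X s)) :
    IsIso ((A.tensor B).galoisMap (i ≫ coactRight A.X s)) := by
  have hq : IsIso ((A.tensor B).galoisMap (coactBoth r s)) := isIso_galoisMap_tensor A B r s
  have hq' : IsIso ((A.tensor B).galoisMap (coactBoth r s ▷ K ≫ (α_ _ _ _).hom)) := by
    rw [galoisMap_whiskerRight_eq]
    infer_instance
  have hb := equalizing_coactBoth hr hi.condition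
  refine (hi.whiskerLeft (A.X ⊗ B.X)).isIso
    ((isCoaction_comul K).isEqualizer.whiskerLeft (A.X ⊗ B.X))
    ((A.tensor B).galoisMap (coactBoth r s))
    ((A.tensor B).galoisMap (coactBoth r s ▷ K ≫ (α_ _ _ _).hom)) ?_ ?_ ?_
  · rw [galoisMap_comp_whiskerLeft, hb, ← whiskerLeft_comp_galoisMap]
  · rw [galoisMap_comp_whiskerLeft, (A.tensor B).whiskerLeft_comp_galoisMap, coactLeft_coactBoth hr]
  · rw [galoisMap_comp_whiskerLeft, (A.tensor B).whiskerLeft_comp_galoisMap, coactRight_coactBoth hs]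

end UnitalMagma

namespace ComoduleMagma

variable {C : Type u} [Category.{v} C] [MonoidalCategory C] [SymmetricCategory C]
  {H : HopfQuasigroup C}

theorem isCoaction (A : ComoduleMagma H) : IsCoaction A.coact :=
  ⟨A.coact_coassoc, A.coact_counit⟩

theorem isEqualizer_incl [HasEqualizers C] (A B : ComoduleMagma H) :
    IsEqualizer (incl A B) (coactLeft A.coact B.X) (coactRight A.X B.coact) :=
  .equalizer_ι (coact₁ A B) (coact₂ A B)

theorem incl_isHom [HasEqualizers C] (A B : ComoduleMagma H) :
    UnitalMagma.IsHom (prodMagma A B) (A.toUnitalMagma.tensor B.toUnitalMagma) (incl A B) :=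
  UnitalMagma.eqMagma_ι (coact₁_isHom A B) (coact₂_isHom A B)

end ComoduleMagma

/-! ### Galois objects: the regular one, products and opposites -/

section Shear

variable {C : Type u} [Category.{v} C] [MonoidalCategory C]

/-- The morphism `x ⊗ l ↦ x₀ ⊗ n (x₁ ⊗ l)` of `X ⊗ L`. -/
def shear {K X L : C} (r : X ⟶ X ⊗ K) (n : K ⊗ L ⟶ L) : X ⊗ L ⟶ X ⊗ L :=
  r ▷ L ≫ (α_ X K L).hom ≫ X ◁ n

/-- If `n' (k₁ ⊗ n (k₂ ⊗ l)) = ε(k) l`, then the shear of `n'` undoes the shear of `n`. Neither of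
the two maps has to be associative. -/
theorem shear_comp {K X L : C} [ComonObj K] {r : X ⟶ X ⊗ K} (hr : IsCoaction r)
    {n n' : K ⊗ L ⟶ L} (h : Δ[K] ▷ L ≫ (α_ K K L).hom ≫ K ◁ n ≫ n' = ε[K] ▷ L ≫ (λ_ L).hom) :
    shear r n ≫ shear r n' = 𝟙 _ := by
  have h1 := hr.coassoc
  have h2 := hr.counit
  calc _ = r ▷ L ≫ (α_ _ _ _).hom ≫ (X ◁ n ≫ r ▷ L) ≫ (α_ _ _ _).hom ≫ X ◁ n' := by
        simp only [shear, Category.assoc]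
    _ = (r ≫ r ▷ K) ▷ L ≫ (α_ _ _ _).hom ▷ L ≫ (α_ _ _ _).hom ≫ X ◁ (α_ K K L).hom ≫
          X ◁ (K ◁ n ≫ n') := by
        rw [whisker_exchange]
        monoidal
    _ = r ▷ L ≫ (α_ _ _ _).hom ≫ X ◁ (Δ[K] ▷ L ≫ (α_ K K L).hom ≫ K ◁ n ≫ n') := by
        rw [h1]
        monoidal
    _ = (r ≫ X ◁ ε[K]) ▷ L ≫ (α_ _ _ _).hom ≫ X ◁ (λ_ L).hom := by
        rw [h]
        monoidal
    _ = _ := by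
        rw [h2]
        monoidal

variable [SymmetricCategory C]

/-- The left-hand side sends `k ⊗ l` to `(l ⊗ k₂) ⊗ k₁`, the right-hand side to `(l ⊗ k₁) ⊗ k₂`. -/
theorem comul_braiding_braiding (K L : C) [ComonObj K] [IsCommComonObj K] :
    Δ[K] ▷ L ≫ (α_ K K L).hom ≫ K ◁ (β_ K L).hom ≫ (β_ K (L ⊗ K)).hom =
      (β_ K L).hom ≫ L ◁ Δ[K] ≫ (α_ L K K).inv := by
  have h : (β_ K L).hom ≫ L ◁ Δ[K] = Δ[K] ▷ L ≫ (β_ (K ⊗ K) L).hom :=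
    (BraidedCategory.braiding_naturality_left _ _).symm
  have h' : (β_ K L).hom ≫ L ◁ Δ[K] = Δ[K] ▷ L ≫ (β_ (K ⊗ K) L).hom ≫ L ◁ (β_ K K).hom := by
    rw [← reassoc_of% h, ← MonoidalCategory.whiskerLeft_comp, IsCommComonObj.comul_comm]
  rw [reassoc_of% h']
  simp only [BraidedCategory.braiding_tensor_right_hom, BraidedCategory.braiding_tensor_left_hom,
    Category.assoc]

end Shear

namespace HopfQuasigroup

variable {C : Type u} [Category.{v} C] [MonoidalCategory C] [SymmetricCategory C]
  (H : HopfQuasigroup C) [IsCommComonObj H.X]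

/-- The antipode of a cocommutative Hopf quasigroup is an involution. -/
theorem antipode_antipode : H.antipode ≫ H.antipode = 𝟙 H.X := by
  have hs : IsComonHom H.antipode :=
    { hom_counit := H.antipode_counit
      hom_comul := by rw [H.antipode_comul, IsCommComonObj.comul_comm_assoc] }
  have h := conv_cancel_left H.mul H.antipode H.antipode_mul_mul (𝟙 H.X) H.antipode
  rw [antipode_conv_id, conv_counit, H.mul_one] at h
  simpa using h

instance : IsIso H.antipode :=
  ⟨H.antipode, H.antipode_antipode, H.antipode_antipode⟩

/-- For a coaction of a cocommutative Hopf quasigroup, `x ⊗ h ↦ x₀ ⊗ h x₁` is invertible, with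
inverse `x ⊗ h ↦ x₀ ⊗ h λ(x₁)`. -/
theorem isIso_shear {X : C} {r : X ⟶ X ⊗ H.X} (hr : IsCoaction r) :
    IsIso (shear r ((β_ H.X H.X).hom ≫ H.mul)) := by
  refine ⟨shear r (H.antipode ▷ H.X ≫ (β_ H.X H.X).hom ≫ H.mul), shear_comp hr ?_,
    shear_comp hr ?_⟩
  · have h := H.mul_mul_antipode
    calc _ = Δ[H.X] ▷ H.X ≫ (α_ _ _ _).hom ≫ H.X ◁ (β_ H.X H.X).hom ≫ (β_ _ _).hom ≫
          (H.mul ⊗ₘ H.antipode) ≫ H.mul := by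
          rw [← BraidedCategory.braiding_naturality_assoc]
          simp [MonoidalCategory.tensorHom_def']
      _ = (β_ H.X H.X).hom ≫ H.X ◁ ε[H.X] ≫ (ρ_ _).hom := by
          rw [reassoc_of% comul_braiding_braiding, h]
      _ = _ := by
          rw [← BraidedCategory.braiding_naturality_left_assoc, braiding_tensorUnit_left]
          simp
  · have h := H.mul_antipode_mul'
    calc _ = Δ[H.X] ▷ H.X ≫ (α_ _ _ _).hom ≫ H.X ◁ (β_ H.X H.X).hom ≫ (β_ _ _).hom ≫
          (H.X ◁ H.antipode ≫ H.mul) ▷ H.X ≫ H.mul := by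
          rw [← BraidedCategory.braiding_naturality_right_assoc]
          simp
      _ = (β_ H.X H.X).hom ≫ H.X ◁ ε[H.X] ≫ (ρ_ _).hom := by
          rw [reassoc_of% comul_braiding_braiding, h]
      _ = _ := by
          rw [← BraidedCategory.braiding_naturality_left_assoc, braiding_tensorUnit_left]
          simp

/-- Up to symmetries, `h ⊗ x ↦ h x₁ ⊗ x₂` is the shear of the coproduct, by cocommutativity. -/
theorem galoisMap_comul : H.toUnitalMagma.galoisMap Δ[H.X] =
    (β_ H.X H.X).hom ≫ shear Δ[H.X] ((β_ H.X H.X).hom ≫ H.mul) ≫ (β_ H.X H.X).hom := by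
  have h : H.X ◁ H.mul ≫ (β_ H.X H.X).hom = (β_ H.X (H.X ⊗ H.X)).hom ≫ H.mul ▷ H.X :=
    BraidedCategory.braiding_naturality_right _ _
  simp only [shear, MonoidalCategory.whiskerLeft_comp, Category.assoc, h,
    reassoc_of% comul_braiding_braiding, SymmetricCategory.symmetry_assoc, UnitalMagma.galoisMap]

/-- `λ(h₂)(h₁ x) = ε(h) x`: by cocommutativity, this is one of the antipode axioms. The composite on
the left-hand side starts by passing from `h ⊗ x` to `x ⊗ h`. -/
theorem braiding_antipode_mul :
    (β_ H.X H.X).hom ≫ H.X ◁ Δ[H.X] ≫ H.X ◁ H.X ◁ H.antipode ≫ (α_ _ _ _).inv ≫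
      (β_ H.X H.X).hom ▷ H.X ≫ H.mul ▷ H.X ≫ (β_ H.X H.X).hom ≫ H.mul =
      ε[H.X] ▷ H.X ≫ (λ_ H.X).hom := by
  have h := H.antipode_mul_mul
  have e : H.mul ▷ H.X ≫ (β_ H.X H.X).hom = (β_ (H.X ⊗ H.X) H.X).hom ≫ H.X ◁ H.mul :=
    BraidedCategory.braiding_naturality_left _ _
  have e1 : (H.X ⊗ H.X) ◁ H.antipode ≫ (β_ H.X H.X).hom ▷ H.X ≫ (β_ (H.X ⊗ H.X) H.X).hom =
      (β_ H.X H.X).hom ▷ H.X ≫ (β_ (H.X ⊗ H.X) H.X).hom ≫ H.antipode ▷ (H.X ⊗ H.X) := by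
    rw [← BraidedCategory.braiding_naturality_right, whisker_exchange_assoc]
  have e2 : (β_ H.X (H.X ⊗ H.X)).hom ≫ (β_ H.X H.X).hom ▷ H.X =
      H.X ◁ (β_ H.X H.X).hom ≫ (β_ H.X (H.X ⊗ H.X)).hom :=
    (BraidedCategory.braiding_naturality_right _ _).symm
  rw [associator_inv_naturality_right_assoc, reassoc_of% e, reassoc_of% e1,
    ← reassoc_of% comul_braiding_braiding, reassoc_of% e2, SymmetricCategory.symmetry_assoc,
    ← MonoidalCategory.whiskerLeft_comp_assoc, SymmetricCategory.symmetry, ← h]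
  simp [MonoidalCategory.tensorHom_def]

end HopfQuasigroup

namespace ComoduleMagma

variable {C : Type u} [Category.{v} C] [MonoidalCategory C] [SymmetricCategory C]
  {H : HopfQuasigroup C}

theorem can_eq (A : ComoduleMagma H) : A.can = coactRight A.X A.coact ≫ A.mul ▷ H.X := by
  simp [can, coactRight]

/-- The morphism `a ⊗ b ↦ a₀ b ⊗ a₁`. -/
def canLeft (A : ComoduleMagma H) : A.X ⊗ A.X ⟶ A.X ⊗ H.X :=
  coactLeft A.coact A.X ≫ A.mul ▷ H.X

theorem mul_coact (A : ComoduleMagma H) :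
    A.mul ≫ A.coact = coactBoth A.coact A.coact ≫ (A.mul ⊗ₘ H.mul) := by
  rw [A.coact_isHom.mul_hom, coactBoth, Category.assoc]

variable [IsCommComonObj H.X]

/-- The canonical morphism of the opposite is `a ⊗ b ↦ b₀ a ⊗ λ(b₁)`. -/
theorem op_can (A : ComoduleMagma H) :
    A.op.can = (β_ A.X A.X).hom ≫ A.canLeft ≫ A.X ◁ H.antipode := by
  rw [canLeft, Category.assoc, reassoc_of% braiding_coactLeft, ← comp_whiskerRight_assoc,
    ← whisker_exchange]
  simp [can, op, coactRight]

/-- `a b₀ ⊗ b₁ = (a₀ b)₀ ⊗ λ(a₁) (a₀ b)₁`. -/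
theorem can_eq_canLeft (A : ComoduleMagma H) :
    A.can = A.canLeft ≫ A.X ◁ H.antipode ≫ shear A.coact ((β_ H.X H.X).hom ≫ H.mul) := by
  have h1 := (A.isCoaction.coactLeft A.X).coassoc
  have h2 := coactLeft_coactRight A.coact A.coact
  have h3 := (A.isCoaction.coactLeft A.X).counit
  have h4 := H.braiding_antipode_mul
  have h5 := A.mul_coact
  rw [coactBoth_eq'] at h5
  rw [can_eq]
  symm
  calc _ = coactLeft A.coact A.X ≫ (A.mul ▷ H.X ≫ A.X ◁ H.antipode) ≫ A.coact ▷ H.X ≫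
        (α_ _ _ _).hom ≫ A.X ◁ ((β_ H.X H.X).hom ≫ H.mul) := by
        simp only [canLeft, shear, Category.assoc]
    _ = coactLeft A.coact A.X ≫ (A.X ⊗ A.X) ◁ H.antipode ≫ (A.mul ≫ A.coact) ▷ H.X ≫
        (α_ _ _ _).hom ≫ A.X ◁ ((β_ H.X H.X).hom ≫ H.mul) := by
        rw [← whisker_exchange]
        simp only [comp_whiskerRight, Category.assoc]
    _ = coactLeft A.coact A.X ≫ ((A.X ⊗ A.X) ◁ H.antipode ≫ coactLeft A.coact A.X ▷ H.X) ≫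
        coactRight A.X A.coact ▷ H.X ▷ H.X ≫ (α_ _ _ _).hom ▷ H.X ≫ (α_ _ _ _).hom ≫
        (A.X ⊗ A.X) ◁ ((β_ H.X H.X).hom ▷ H.X ≫ H.mul ▷ H.X ≫ (β_ H.X H.X).hom ≫ H.mul) ≫
        A.mul ▷ H.X := by
        have e (n : H.X ⊗ H.X ⟶ H.X) : (A.mul ⊗ₘ H.mul) ▷ H.X ≫ (α_ _ _ _).hom ≫ A.X ◁ n =
            (α_ _ _ _).hom ≫ (A.X ⊗ A.X) ◁ (H.mul ▷ H.X ≫ n) ≫ A.mul ▷ H.X := by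
          rw [whisker_exchange, MonoidalCategory.tensorHom_def]
          monoidal
        rw [h5]
        simp only [comp_whiskerRight, Category.assoc, e]
        monoidal
    _ = (coactLeft A.coact A.X ≫ coactLeft A.coact A.X ▷ H.X) ≫
        (((A.X ⊗ A.X) ⊗ H.X) ◁ H.antipode ≫
        coactRight A.X A.coact ▷ H.X ▷ H.X) ≫ (α_ _ _ _).hom ▷ H.X ≫ (α_ _ _ _).hom ≫
        (A.X ⊗ A.X) ◁ ((β_ H.X H.X).hom ▷ H.X ≫ H.mul ▷ H.X ≫ (β_ H.X H.X).hom ≫ H.mul) ≫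
        A.mul ▷ H.X := by
        rw [whisker_exchange]
        simp only [Category.assoc]
    _ = coactLeft A.coact A.X ≫ ((A.X ⊗ A.X) ◁ Δ[H.X] ≫ (A.X ⊗ A.X) ◁ H.X ◁ H.antipode ≫
          coactRight A.X A.coact ▷ (H.X ⊗ H.X)) ≫ (α_ _ _ _).inv ≫
        (α_ _ _ _).hom ▷ H.X ≫ (α_ _ _ _).hom ≫
        (A.X ⊗ A.X) ◁ ((β_ H.X H.X).hom ▷ H.X ≫ H.mul ▷ H.X ≫ (β_ H.X H.X).hom ≫ H.mul) ≫
        A.mul ▷ H.X := by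
        rw [h1]
        monoidal
    _ = (coactLeft A.coact A.X ≫ coactRight A.X A.coact ▷ H.X) ≫ (α_ _ _ _).hom ≫
        (A.X ⊗ A.X) ◁ (H.X ◁ Δ[H.X] ≫ H.X ◁ H.X ◁ H.antipode ≫ (α_ _ _ _).inv ≫
          (β_ H.X H.X).hom ▷ H.X ≫ H.mul ▷ H.X ≫ (β_ H.X H.X).hom ≫ H.mul) ≫
        A.mul ▷ H.X := by
        rw [whisker_exchange, whisker_exchange_assoc]
        monoidal
    _ = coactRight A.X A.coact ≫ coactLeft A.coact A.X ▷ H.X ≫ (α_ _ _ _).hom ≫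
        (A.X ⊗ A.X) ◁ ((β_ H.X H.X).hom ≫ H.X ◁ Δ[H.X] ≫ H.X ◁ H.X ◁ H.antipode ≫
          (α_ _ _ _).inv ≫
          (β_ H.X H.X).hom ▷ H.X ≫ H.mul ▷ H.X ≫ (β_ H.X H.X).hom ≫ H.mul) ≫
        A.mul ▷ H.X := by
        rw [h2]
        simp only [Category.assoc, Iso.inv_hom_id_assoc, MonoidalCategory.whiskerLeft_comp]
    _ = coactRight A.X A.coact ≫ (coactLeft A.coact A.X ≫ (A.X ⊗ A.X) ◁ ε[H.X]) ▷ H.X ≫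
        (α_ _ _ _).hom ≫ (A.X ⊗ A.X) ◁ (λ_ _).hom ≫ A.mul ▷ H.X := by
        rw [h4]
        simp
    _ = _ := by
        rw [h3]
        simp

end ComoduleMagma

section Galois

variable {C : Type u} [Category.{v} C] [MonoidalCategory C] [SymmetricCategory C]
  {H : HopfQuasigroup C} [IsCommComonObj H.X]

theorem isGalois_regular [hH : FaithfullyFlat H.X] : IsGalois (ComoduleMagma.regular H) := by
  refine ⟨hH, ?_⟩
  change IsIso (H.toUnitalMagma.galoisMap Δ[H.X])
  have := H.isIso_shear (isCoaction_comul H.X)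
  rw [H.galoisMap_comul]
  infer_instance

/-- The product `P` of Galois objects is Galois: since `A ⊗ B ⊗ P` is isomorphic to `A ⊗ B ⊗ H`,
faithful flatness descends to `P`, and then the invertibility of the Galois morphism passes from
`A ⊗ B ⊗ P` to the equalizer `P ⊗ P`. -/
theorem IsGalois.prod [HasEqualizers C] [hH : FaithfullyFlat H.X] {A B : ComoduleMagma H}
    (hA : IsGalois A) (hB : IsGalois B) : IsGalois (A.prod B) := by
  have hAB := hA.faithfullyFlat.tensor hB.faithfullyFlat
  have : IsIso (A.toUnitalMagma.galoisMap A.coact) := hA.isIso_can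
  have : IsIso (B.toUnitalMagma.galoisMap B.coact) := hB.isIso_can
  have : IsIso (H.toUnitalMagma.galoisMap Δ[H.X]) := isGalois_regular.isIso_can
  have hi := ComoduleMagma.isEqualizer_incl A B
  have hθ := UnitalMagma.isIso_galoisMap_coactRight A.isCoaction B.isCoaction hi
  have hP : FaithfullyFlat (ComoduleMagma.prodMagma A B).X :=
    hAB.of_tensor ((hAB.tensor hH).of_iso (asIso ((A.tensor B.toUnitalMagma).galoisMap
      (ComoduleMagma.incl A B ≫ coactRight A.X B.coact))).symm)
  have : Flat (ComoduleMagma.prodMagma A B).X := hP.toFlat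
  refine ⟨hP, ?_⟩
  exact UnitalMagma.isIso_galoisMap_of_isEqualizer (N := H.toUnitalMagma)
    (P := ComoduleMagma.prodMagma A B) (r := ComoduleMagma.prodCoact A B)
    (r₁ := coactLeft A.coact B.X) (r₂ := coactRight A.X B.coact)
    (A.prod B).isCoaction (ComoduleMagma.incl_isHom A B) (ComoduleMagma.coact₁_isHom A B)
    (ComoduleMagma.coact₂_isHom A B) hi (ComoduleMagma.prodCoact_incl A B)

theorem IsGalois.isIso_canLeft {A : ComoduleMagma H} (hA : IsGalois A) : IsIso A.canLeft := by
  have h1 := hA.isIso_can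
  have h2 := H.isIso_shear A.isCoaction
  rw [A.can_eq_canLeft] at h1
  exact IsIso.of_isIso_comp_right _ (A.X ◁ H.antipode ≫ shear A.coact ((β_ H.X H.X).hom ≫ H.mul))

theorem IsGalois.op {A : ComoduleMagma H} (hA : IsGalois A) : IsGalois A.op := by
  refine ⟨hA.faithfullyFlat, ?_⟩
  have := hA.isIso_canLeft
  have h : IsIso ((β_ A.X A.X).hom ≫ A.canLeft ≫ A.X ◁ H.antipode) := inferInstance
  rwa [← A.op_can] at h

end Galois

/-! ### Translation morphisms and strong Galois objects -/

namespace HopfQuasigroup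

variable {C : Type u} [Category.{v} C] [MonoidalCategory C] [SymmetricCategory C]
  (H : HopfQuasigroup C)

theorem isHom_antipode : UnitalMagma.IsHom H.toUnitalMagma H.toUnitalMagma.op H.antipode := by
  refine ⟨H.one_antipode, ?_⟩
  rw [H.mul_antipode, BraidedCategory.braiding_naturality_assoc]

theorem id_conv_antipode : conv H.mul (𝟙 H.X) H.antipode = ε[H.X] ≫ H.one := by
  have h := conv_cancel_right H.mul H.antipode H.mul_mul_antipode (ε[H.X] ≫ H.one) (𝟙 H.X)
  rw [counit_conv, H.one_mul] at h
  simpa using h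

/-- `h₁ λ(h₂)₁ ⊗ λ(h₂)₂ = 1 ⊗ λ(h)`. -/
theorem comul_antipode_comul [IsCommComonObj H.X] :
    Δ[H.X] ≫ H.X ◁ H.antipode ≫ H.X ◁ Δ[H.X] ≫ (α_ _ _ _).inv ≫ H.mul ▷ H.X =
      H.antipode ≫ (λ_ H.X).inv ≫ H.one ▷ H.X := by
  have h1 := H.antipode_comul
  rw [IsCommComonObj.comul_comm_assoc] at h1
  have h2 := H.id_conv_antipode
  rw [conv, id_tensorHom] at h2
  have h3 : Δ[H.X] ≫ H.X ◁ Δ[H.X] ≫ (α_ _ _ _).inv = Δ[H.X] ≫ Δ[H.X] ▷ H.X := by simp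
  calc _ = Δ[H.X] ≫ H.X ◁ (H.antipode ≫ Δ[H.X]) ≫ (α_ _ _ _).inv ≫ H.mul ▷ H.X := by
        simp
    _ = (Δ[H.X] ≫ H.X ◁ Δ[H.X] ≫ (α_ _ _ _).inv) ≫ (H.X ◁ H.antipode) ▷ H.X ≫
          (H.X ⊗ H.X) ◁ H.antipode ≫ H.mul ▷ H.X := by
        rw [h1, MonoidalCategory.tensorHom_def]
        monoidal
    _ = Δ[H.X] ≫ (Δ[H.X] ≫ H.X ◁ H.antipode ≫ H.mul) ▷ H.X ≫ H.X ◁ H.antipode := by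
        rw [h3, whisker_exchange]
        monoidal
    _ = (Δ[H.X] ≫ ε[H.X] ▷ H.X) ≫ (H.one ▷ H.X ≫ H.X ◁ H.antipode) := by
        rw [h2]
        simp
    _ = _ := by
        rw [← whisker_exchange, ComonObj.counit_comul]
        simp

/-- The coinvariants of `H` are trivial: apply the counit to the first factor. -/
theorem isEqualizer_one :
    IsEqualizer H.one Δ[H.X] ((ρ_ H.X).inv ≫ H.X ◁ H.one) := by
  have h1 := H.counit_isHom.one_hom
  have h2 := H.comul_isHom.one_hom
  dsimp only at h1 h2
  refine .of_exists_lift ?_ ?_ fun x hx => ⟨x ≫ ε[H.X], ?_⟩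
  · rw [h2, MonoidalCategory.tensorHom_def, rightUnitor_inv_naturality_assoc, unitors_inv_equal]
  · have : Mono (H.one ≫ ε[H.X]) := by
      rw [h1]
      infer_instance
    exact mono_of_mono _ ε[H.X]
  · have h := congrArg (· ≫ ε[H.X] ▷ H.X ≫ (λ_ _).hom) hx
    simp only [Category.assoc, ComonObj.counit_comul_assoc, Iso.inv_hom_id, Category.comp_id,
      whisker_exchange_assoc] at h
    rw [h]
    simp [reassoc_of% h1]

end HopfQuasigroup

namespace UnitalMagma

variable {C : Type u} [Category.{v} C] [MonoidalCategory C] [SymmetricCategory C]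

/-- The translation morphism `h` of a subobject `P` of `A ⊗ B` on which the two coactions agree is
given by the translation morphisms `f` and `g` of the factors. -/
theorem translation_tensor {A B : UnitalMagma C} {K : C} [ComonObj K] {r : A.X ⟶ A.X ⊗ K}
    {s : B.X ⟶ B.X ⊗ K} (hr : IsCoaction r) [IsIso (A.galoisMap r)] [IsIso (B.galoisMap s)]
    {f : K ⟶ A.X ⊗ A.X} (hf : f ≫ A.galoisMap r = (λ_ K).inv ≫ A.one ▷ K)
    {g : K ⟶ B.X ⊗ B.X} (hg : g ≫ B.galoisMap s = (λ_ K).inv ≫ B.one ▷ K)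
    {P : UnitalMagma C} {i : P.X ⟶ A.X ⊗ B.X} (hi : IsHom P (A.tensor B) i)
    (hc : i ≫ coactLeft r B.X = i ≫ coactRight A.X s) {t : P.X ⟶ P.X ⊗ K}
    (ht : t ≫ i ▷ K = i ≫ coactRight A.X s) {h : K ⟶ P.X ⊗ P.X}
    (hh : h ≫ P.galoisMap t = (λ_ K).inv ≫ P.one ▷ K) :
    h ≫ (i ⊗ₘ i) = Δ[K] ≫ (f ⊗ₘ g) ≫ tensorμ A.X A.X B.X B.X := by
  have hq : IsIso ((A.tensor B).galoisMap (coactBoth r s)) := isIso_galoisMap_tensor A B r s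
  have h1 : (i ⊗ₘ i) ≫ (A.tensor B).galoisMap (coactBoth r s) =
      P.galoisMap t ≫ (i ⊗ₘ Δ[K]) := by
    refine (hi.galoisMap t (coactBoth r s) i Δ[K] ?_).symm
    rw [MonoidalCategory.tensorHom_def, reassoc_of% ht, ← equalizing_coactBoth hr hc,
      Category.assoc]
  have h2 := hi.one_hom
  have h3 : (f ⊗ₘ g) ≫ (A.galoisMap r ⊗ₘ B.galoisMap s) =
      ((λ_ K).inv ⊗ₘ (λ_ K).inv) ≫ (A.one ▷ K ⊗ₘ B.one ▷ K) := by
    rw [tensorHom_comp_tensorHom, tensorHom_comp_tensorHom, hf, hg]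
  have h4 : (A.one ▷ K ⊗ₘ B.one ▷ K) ≫ tensorμ A.X K B.X K =
      tensorμ (𝟙_ C) K (𝟙_ C) K ≫ (A.one ⊗ₘ B.one) ▷ (K ⊗ K) := by
    simpa using tensorμ_natural A.one (𝟙 K) B.one (𝟙 K)
  have h5 : ((λ_ K).inv ⊗ₘ (λ_ K).inv) ≫ tensorμ (𝟙_ C) K (𝟙_ C) K =
      (λ_ (K ⊗ K)).inv ≫ (λ_ (𝟙_ C)).inv ▷ (K ⊗ K) := by
    rw [← cancel_mono ((λ_ (𝟙_ C)).hom ▷ (K ⊗ K) ≫ (λ_ (K ⊗ K)).hom), Category.assoc,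
      ← leftUnitor_monoidal, tensorHom_comp_tensorHom]
    simp
  rw [← cancel_mono ((A.tensor B).galoisMap (coactBoth r s)), Category.assoc, h1, reassoc_of% hh]
  simp only [Category.assoc]
  have h6 := galoisMap_tensor A B r s
  unfold coactBoth
  rw [h6, tensorμ_tensorμ_assoc, reassoc_of% h3, h4, reassoc_of% h5,
    MonoidalCategory.tensorHom_def, ← comp_whiskerRight_assoc, h2, ← whisker_exchange]
  monoidal

end UnitalMagma

namespace ComoduleMagma

variable {C : Type u} [Category.{v} C] [MonoidalCategory C] [SymmetricCategory C]
  {H : HopfQuasigroup C}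

theorem translation_can (A : ComoduleMagma H) [IsIso A.can] :
    A.translation ≫ A.can = (λ_ H.X).inv ≫ A.one ▷ H.X := by
  simp [translation]

theorem eq_translation (A : ComoduleMagma H) [IsIso A.can] {x : H.X ⟶ A.X ⊗ A.X}
    (hx : x ≫ A.can = (λ_ H.X).inv ≫ A.one ▷ H.X) : x = A.translation := by
  rw [← cancel_mono A.can, hx, translation_can]

theorem one_coact (A : ComoduleMagma H) :
    A.one ≫ A.coact = A.one ≫ (ρ_ A.X).inv ≫ A.X ◁ H.one := by
  rw [A.coact_isHom.one_hom]
  dsimp only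
  rw [MonoidalCategory.tensorHom_def, rightUnitor_inv_naturality_assoc,
    unitors_inv_equal]

theorem translation_regular [IsIso (regular H).can] :
    (regular H).translation = Δ[H.X] ≫ H.antipode ▷ H.X := by
  refine (eq_translation (regular H) ?_).symm
  change (Δ[H.X] ≫ H.antipode ▷ H.X) ≫ H.X ◁ Δ[H.X] ≫ (α_ _ _ _).inv ≫ H.mul ▷ H.X =
    (λ_ H.X).inv ≫ H.one ▷ H.X
  have h2 := H.antipode_conv_id
  rw [HopfQuasigroup.conv, tensorHom_id] at h2
  have h3 : Δ[H.X] ≫ H.X ◁ Δ[H.X] ≫ (α_ _ _ _).inv = Δ[H.X] ≫ Δ[H.X] ▷ H.X := by simp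
  calc _ = (Δ[H.X] ≫ H.X ◁ Δ[H.X] ≫ (α_ _ _ _).inv) ≫ H.antipode ▷ H.X ▷ H.X ≫ H.mul ▷ H.X := by
        rw [Category.assoc, ← whisker_exchange_assoc]
        monoidal
    _ = Δ[H.X] ≫ (Δ[H.X] ≫ H.antipode ▷ H.X ≫ H.mul) ▷ H.X := by
        rw [h3]
        simp
    _ = _ := by
        rw [h2]
        simp

theorem unit_shear (A : ComoduleMagma H) :
    ((λ_ H.X).inv ≫ A.one ▷ H.X) ≫ shear A.coact ((β_ H.X H.X).hom ≫ H.mul) =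
      (λ_ H.X).inv ≫ A.one ▷ H.X := by
  have h := A.one_coact
  have h1 : H.one ▷ H.X ≫ (β_ H.X H.X).hom ≫ H.mul = (λ_ H.X).hom := by
    simp [H.mul_one]
  calc _ = (λ_ H.X).inv ≫ (A.one ≫ A.coact) ▷ H.X ≫ (α_ _ _ _).hom ≫
        A.X ◁ ((β_ H.X H.X).hom ≫ H.mul) := by
        simp [shear]
    _ = (λ_ H.X).inv ≫ A.one ▷ H.X ≫ A.X ◁ (λ_ _).inv ≫
        A.X ◁ (H.one ▷ H.X ≫ (β_ H.X H.X).hom ≫ H.mul) := by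
        rw [h]
        monoidal
    _ = _ := by
        rw [h1]
        simp

variable [IsCommComonObj H.X]

theorem translation_canLeft_antipode (A : ComoduleMagma H) [IsIso A.can] :
    A.translation ≫ A.canLeft ≫ A.X ◁ H.antipode = (λ_ H.X).inv ≫ A.one ▷ H.X := by
  have := H.isIso_shear A.isCoaction
  rw [← cancel_mono (shear A.coact ((β_ H.X H.X).hom ≫ H.mul)), unit_shear, Category.assoc,
    Category.assoc, ← can_eq_canLeft, translation_can]

theorem translation_canLeft (A : ComoduleMagma H) [IsIso A.can] :
    A.translation ≫ A.canLeft = (λ_ H.X).inv ≫ A.one ▷ H.X ≫ A.X ◁ H.antipode := by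
  rw [← cancel_mono (A.X ◁ H.antipode), Category.assoc, translation_canLeft_antipode]
  simp [← MonoidalCategory.whiskerLeft_comp, H.antipode_antipode]

theorem translation_op (A : ComoduleMagma H) [IsIso A.can] [IsIso A.op.can] :
    A.op.translation = A.translation ≫ (β_ A.X A.X).hom := by
  refine (eq_translation A.op ?_).symm
  rw [op_can]
  change (A.translation ≫ (β_ A.X A.X).hom) ≫ (β_ A.X A.X).hom ≫ A.canLeft ≫
    A.X ◁ H.antipode = (λ_ H.X).inv ≫ A.one ▷ H.X
  simpa using A.translation_canLeft_antipode

end ComoduleMagma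

section Galois

variable {C : Type u} [Category.{v} C] [MonoidalCategory C] [SymmetricCategory C]
  {H : HopfQuasigroup C} [IsCommComonObj H.X]

theorem isStrongGalois_regular [hH : FaithfullyFlat H.X] :
    IsStrongGalois (ComoduleMagma.regular H) := by
  have h := isGalois_regular (H := H)
  have := h.isIso_can
  refine ⟨h, ?_⟩
  rw [ComoduleMagma.translation_regular]
  exact H.comul_isHom.comp (H.isHom_antipode.whiskerRight H.toUnitalMagma)

theorem IsStrongGalois.op {A : ComoduleMagma H} (hA : IsStrongGalois A) :
    IsStrongGalois A.op := by
  have h := hA.toIsGalois.op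
  have := hA.isIso_can
  have := h.isIso_can
  have hop : UnitalMagma.IsHom A.toUnitalMagma A.toUnitalMagma.op.op (𝟙 A.X) :=
    ⟨by simp, by simp⟩
  refine ⟨h, ?_⟩
  rw [ComoduleMagma.translation_op]
  have := (hA.translation_isHom.comp (UnitalMagma.isHom_braiding _ _)).comp
    (hop.whiskerRight A.toUnitalMagma.op)
  rw [id_whiskerRight, Category.comp_id] at this
  exact this

/-- Along the inclusion into `A ⊗ B`, the translation morphism of the product is the coproduct of
`H` followed by the translation morphisms of the factors, which is a morphism of unital magmas. -/
theorem IsStrongGalois.prod [HasEqualizers C] [hH : FaithfullyFlat H.X] {A B : ComoduleMagma H}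
    (hA : IsStrongGalois A) (hB : IsStrongGalois B) : IsStrongGalois (A.prod B) := by
  have h := IsGalois.prod hA.toIsGalois hB.toIsGalois
  have := hA.isIso_can
  have := hB.isIso_can
  have := h.isIso_can
  have hi := ComoduleMagma.incl_isHom A B
  have hmono : Mono (ComoduleMagma.incl A B ⊗ₘ ComoduleMagma.incl A B) := by
    have hP : Flat (ComoduleMagma.prodMagma A B).X := h.faithfullyFlat.toFlat
    have hAB : Flat (A.X ⊗ B.X) := (hA.faithfullyFlat.tensor hB.faithfullyFlat).toFlat
    have := ((ComoduleMagma.isEqualizer_incl A B).whiskerRight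
      (ComoduleMagma.prodMagma A B).X).mono
    have := ((ComoduleMagma.isEqualizer_incl A B).whiskerLeft (A.X ⊗ B.X)).mono
    rw [MonoidalCategory.tensorHom_def]
    infer_instance
  refine ⟨h, UnitalMagma.IsHom.of_mono (B := (ComoduleMagma.prodMagma A B).env)
    (hi.op.tensor hi) ?_⟩
  have hop : UnitalMagma.IsHom (A.toUnitalMagma.op.tensor B.toUnitalMagma.op)
      (A.toUnitalMagma.tensor B.toUnitalMagma).op (𝟙 (A.X ⊗ B.X)) :=
    UnitalMagma.IsHom.inv (A := (A.toUnitalMagma.tensor B.toUnitalMagma).op)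
      (B := A.toUnitalMagma.op.tensor B.toUnitalMagma.op) (e := Iso.refl _)
      (UnitalMagma.isHom_op_tensor _ _)
  have k := ((H.comul_isHom.comp (hA.translation_isHom.tensor hB.translation_isHom)).comp
    (UnitalMagma.isHom_tensorμ _ _ _ _)).comp
      (hop.whiskerRight (A.toUnitalMagma.tensor B.toUnitalMagma))
  rw [id_whiskerRight, Category.comp_id, Category.assoc] at k
  have : IsIso (A.galoisMap A.coact) := hA.isIso_can
  have : IsIso (B.galoisMap B.coact) := hB.isIso_can
  have e := UnitalMagma.translation_tensor (P := ComoduleMagma.prodMagma A B)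
    (t := ComoduleMagma.prodCoact A B) A.isCoaction A.translation_can B.translation_can hi
    (ComoduleMagma.isEqualizer_incl A B).condition (ComoduleMagma.prodCoact_incl A B)
    (A.prod B).translation_can
  rw [← e] at k
  exact k

end Galois

/-! ### Coinvariants and the equalizer property of the translation morphism -/

namespace ComoduleMagma

variable {C : Type u} [Category.{v} C] [MonoidalCategory C] [SymmetricCategory C]
  {H : HopfQuasigroup C}

/-- The coinvariants of a Galois object are trivial: the unit is the equalizer of the coaction and
`a ↦ a ⊗ 1`. After tensoring with `A`, the canonical morphism identifies this with the
corresponding statement for `H`. -/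
theorem isEqualizer_one [HasEqualizers C] {A : ComoduleMagma H} (hA : IsGalois A) :
    IsEqualizer A.one A.coact ((ρ_ A.X).inv ≫ A.X ◁ H.one) := by
  have := hA.faithfullyFlat
  have hγ : IsIso (A.galoisMap A.coact) := hA.isIso_can
  have hγ' : IsIso (A.galoisMap (A.coact ▷ H.X ≫ (α_ _ _ _).hom)) := by
    rw [UnitalMagma.galoisMap_whiskerRight_eq]
    infer_instance
  have h1 : A.coact ≫ A.coact ▷ H.X ≫ (α_ _ _ _).hom = A.coact ≫ A.X ◁ Δ[H.X] := by
    have h := A.coact_coassoc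
    rw [reassoc_of% h]
    simp
  have h2 : A.X ◁ A.one ≫ A.galoisMap A.coact = A.X ◁ H.one := by
    have h := A.mul_one
    rw [UnitalMagma.whiskerLeft_comp_galoisMap, one_coact, ← Category.assoc,
      ← UnitalMagma.galoisMap_comp_whiskerLeft]
    have e : A.galoisMap (A.one ≫ (ρ_ A.X).inv) = (A.X ◁ A.one ≫ A.mul) ≫ (ρ_ A.X).inv := by
      simp [UnitalMagma.galoisMap]
    rw [e, h]
    simp
  refine .of_whiskerLeft A.X ((H.isEqualizer_one.whiskerLeft A.X).of_iso (𝟙 _)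
    (inv (A.galoisMap A.coact)) (inv (A.galoisMap (A.coact ▷ H.X ≫ (α_ _ _ _).hom))) ?_ ?_ ?_)
  · rw [Category.id_comp, IsIso.eq_comp_inv, h2]
  · rw [IsIso.comp_inv_eq, Category.assoc, IsIso.eq_inv_comp,
      UnitalMagma.whiskerLeft_comp_galoisMap, UnitalMagma.galoisMap_comp_whiskerLeft, h1]
  · rw [IsIso.comp_inv_eq, Category.assoc, IsIso.eq_inv_comp,
      UnitalMagma.whiskerLeft_comp_galoisMap, UnitalMagma.galoisMap_comp_whiskerLeft]
    congr 1
    rw [Category.assoc, whisker_exchange_assoc]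
    simp

theorem unit_comul (A : ComoduleMagma H) {k : H.X ⟶ H.X ⊗ H.X} :
    ((λ_ H.X).inv ≫ A.one ▷ H.X) ≫ A.X ◁ k ≫ (α_ _ _ _).inv =
      k ≫ ((λ_ H.X).inv ≫ A.one ▷ H.X) ▷ H.X := by
  rw [Category.assoc, ← whisker_exchange_assoc]
  monoidal

/-- The translation morphism is colinear for the coaction of the second factor. -/
theorem translation_coactRight (A : ComoduleMagma H) [IsIso A.can] :
    A.translation ≫ coactRight A.X A.coact = Δ[H.X] ≫ A.translation ▷ H.X := by
  have h := (A.isCoaction.coactRight A.X).coassoc_comp A.mul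
  rw [← can_eq] at h
  rw [← cancel_mono (A.can ▷ H.X), Category.assoc, h, reassoc_of% translation_can, Category.assoc,
    ← comp_whiskerRight, translation_can, ← unit_comul, Category.assoc]

theorem mono_translation (A : ComoduleMagma H) [HasEqualizers C] [Flat H.X] (hA : IsGalois A)
    [IsIso A.can] : Mono A.translation := by
  have h := ((isEqualizer_one hA).whiskerRight H.X).mono
  have : Mono (A.translation ≫ A.can) := by
    rw [translation_can]
    infer_instance
  exact mono_of_mono _ A.can

variable [IsCommComonObj H.X]

theorem translation_coactLeft {A : ComoduleMagma H} (hA : IsGalois A) [IsIso A.can] :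
    A.translation ≫ coactLeft (A.coact ≫ A.X ◁ H.antipode) A.X =
      Δ[H.X] ≫ A.translation ▷ H.X := by
  have := hA.isIso_canLeft
  have h : coactLeft A.coact A.X ≫ A.canLeft ▷ H.X = A.canLeft ≫ A.X ◁ Δ[H.X] ≫ (α_ _ _ _).inv :=
    (A.isCoaction.coactLeft A.X).coassoc_comp A.mul
  have h1 := H.antipode_comul
  rw [IsCommComonObj.comul_comm_assoc] at h1
  have h2 : H.antipode ≫ Δ[H.X] ≫ H.X ◁ H.antipode = Δ[H.X] ≫ H.antipode ▷ H.X := by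
    rw [reassoc_of% h1, MonoidalCategory.tensorHom_def, Category.assoc,
      ← MonoidalCategory.whiskerLeft_comp, H.antipode_antipode]
    simp
  rw [← cancel_mono (A.canLeft ▷ H.X), coactLeft_comp_whiskerLeft]
  calc _ = (A.translation ≫ A.canLeft) ≫ A.X ◁ Δ[H.X] ≫ (α_ _ _ _).inv ≫
        (A.X ⊗ H.X) ◁ H.antipode := by
        rw [Category.assoc, Category.assoc, whisker_exchange, reassoc_of% h, Category.assoc]
    _ = ((λ_ H.X).inv ≫ A.one ▷ H.X) ≫ A.X ◁ (H.antipode ≫ Δ[H.X] ≫ H.X ◁ H.antipode) ≫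
        (α_ _ _ _).inv := by
        rw [translation_canLeft]
        simp
    _ = _ := by
        have h3 : H.antipode ≫ (λ_ H.X).inv ≫ A.one ▷ H.X =
            (λ_ H.X).inv ≫ A.one ▷ H.X ≫ A.X ◁ H.antipode := by
          rw [← whisker_exchange, leftUnitor_inv_naturality_assoc]
        rw [h2, unit_comul, Category.assoc, ← comp_whiskerRight, h3, ← translation_canLeft,
          comp_whiskerRight, Category.assoc]

/-- If the two coactions of `A.op ⊗ A` agree on `x`, then `can x` is coinvariant in the factor
`A`. -/
theorem can_coact {A : ComoduleMagma H} {T : C} {x : T ⟶ A.X ⊗ A.X}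
    (hx : x ≫ coactLeft (A.coact ≫ A.X ◁ H.antipode) A.X = x ≫ coactRight A.X A.coact) :
    (x ≫ A.can) ≫ A.coact ▷ H.X = (x ≫ A.can) ≫ ((ρ_ A.X).inv ≫ A.X ◁ H.one) ▷ H.X := by
  rw [coactLeft_comp_whiskerLeft] at hx
  have h1 := (A.isCoaction.coactLeft A.X).coassoc
  have h2 := (A.isCoaction.coactRight A.X).coassoc
  have h5 := A.mul_coact
  rw [coactBoth_eq] at h5
  have h6 := H.comul_antipode_comul
  have e : (A.mul ⊗ₘ H.mul) ▷ H.X =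
      (α_ _ _ _).hom ≫ (A.X ⊗ A.X) ◁ (H.mul ▷ H.X) ≫ (α_ _ _ _).inv ≫ A.mul ▷ H.X ▷ H.X := by
    rw [MonoidalCategory.tensorHom_def']
    simp
  calc _ = x ≫ (coactRight A.X A.coact ≫ coactRight A.X A.coact ▷ H.X) ≫
        coactLeft A.coact A.X ▷ H.X ▷ H.X ≫ (α_ _ _ _).hom ▷ H.X ≫ (α_ _ _ _).hom ≫
          (A.X ⊗ A.X) ◁ (H.mul ▷ H.X) ≫ (α_ _ _ _).inv ≫ A.mul ▷ H.X ▷ H.X := by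
        rw [can_eq, Category.assoc, Category.assoc, ← comp_whiskerRight, h5]
        simp only [comp_whiskerRight, Category.assoc, e]
    _ = (x ≫ coactRight A.X A.coact) ≫ ((A.X ⊗ A.X) ◁ Δ[H.X] ≫
          coactLeft A.coact A.X ▷ (H.X ⊗ H.X)) ≫ (α_ _ _ _).hom ≫
          (A.X ⊗ A.X) ◁ ((α_ _ _ _).inv ≫ H.mul ▷ H.X) ≫ (α_ _ _ _).inv ≫
          A.mul ▷ H.X ▷ H.X := by
        rw [h2]
        monoidal
    _ = x ≫ coactLeft A.coact A.X ≫ ((A.X ⊗ A.X) ◁ (H.antipode ≫ Δ[H.X]) ≫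
          coactLeft A.coact A.X ▷ (H.X ⊗ H.X)) ≫ (α_ _ _ _).hom ≫
          (A.X ⊗ A.X) ◁ ((α_ _ _ _).inv ≫ H.mul ▷ H.X) ≫ (α_ _ _ _).inv ≫
          A.mul ▷ H.X ▷ H.X := by
        rw [← hx]
        simp
    _ = x ≫ (coactLeft A.coact A.X ≫ coactLeft A.coact A.X ▷ H.X) ≫
          ((A.X ⊗ A.X) ⊗ H.X) ◁ (H.antipode ≫ Δ[H.X]) ≫ (α_ _ _ _).hom ≫
          (A.X ⊗ A.X) ◁ ((α_ _ _ _).inv ≫ H.mul ▷ H.X) ≫ (α_ _ _ _).inv ≫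
          A.mul ▷ H.X ▷ H.X := by
        rw [whisker_exchange]
        simp only [Category.assoc]
    _ = x ≫ coactLeft A.coact A.X ≫ (A.X ⊗ A.X) ◁ (Δ[H.X] ≫ H.X ◁ H.antipode ≫
          H.X ◁ Δ[H.X] ≫ (α_ _ _ _).inv ≫ H.mul ▷ H.X) ≫ (α_ _ _ _).inv ≫
          A.mul ▷ H.X ▷ H.X := by
        rw [h1]
        monoidal
    _ = (x ≫ coactLeft A.coact A.X ≫ (A.X ⊗ A.X) ◁ H.antipode) ≫
          (A.X ⊗ A.X) ◁ ((λ_ H.X).inv ≫ H.one ▷ H.X) ≫ (α_ _ _ _).inv ≫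
          A.mul ▷ H.X ▷ H.X := by
        rw [h6]
        simp
    _ = x ≫ coactRight A.X A.coact ≫
          ((ρ_ (A.X ⊗ A.X)).inv ≫ (A.X ⊗ A.X) ◁ H.one ≫ A.mul ▷ H.X) ▷ H.X := by
        rw [hx]
        monoidal
    _ = _ := by
        have e' : (ρ_ (A.X ⊗ A.X)).inv ≫ (A.X ⊗ A.X) ◁ H.one ≫ A.mul ▷ H.X =
            A.mul ≫ (ρ_ A.X).inv ≫ A.X ◁ H.one := by
          rw [whisker_exchange, ← rightUnitor_inv_naturality_assoc]
        rw [e', can_eq, comp_whiskerRight, Category.assoc, Category.assoc]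

/-- The translation morphism identifies `H` with the equalizer defining the product of the
opposite of `A` with `A`. -/
theorem isEqualizer_translation [HasEqualizers C] [Flat H.X] {A : ComoduleMagma H}
    (hA : IsGalois A) [IsIso A.can] :
    IsEqualizer A.translation (coactLeft (A.coact ≫ A.X ◁ H.antipode) A.X)
      (coactRight A.X A.coact) := by
  refine .of_exists_lift ((translation_coactLeft hA).trans A.translation_coactRight.symm)
    (mono_translation A hA) fun {T} x hx => ?_
  obtain ⟨y, hy⟩ := ((isEqualizer_one hA).whiskerRight H.X).exists_lift (x ≫ A.can) (can_coact hx)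
  refine ⟨y ≫ (λ_ H.X).hom, ?_⟩
  rw [← cancel_mono A.can, Category.assoc, Category.assoc, translation_can, Iso.hom_inv_id_assoc,
    hy]

end ComoduleMagma

/-! ### Naturality and associativity of the two coactions -/

section Coaction

variable {C : Type u} [Category.{v} C] [MonoidalCategory C] {K X X' Y Y' Z : C}

theorem tensorHom_coactRight {s : Y ⟶ Y ⊗ K} {s' : Y' ⟶ Y' ⊗ K} (f : X ⟶ X') {g : Y ⟶ Y'}
    (hg : g ≫ s' = s ≫ g ▷ K) :
    (f ⊗ₘ g) ≫ coactRight X' s' = coactRight X s ≫ (f ⊗ₘ g) ▷ K := by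
  simp only [coactRight, MonoidalCategory.tensorHom_def, comp_whiskerRight, Category.assoc,
    ← MonoidalCategory.whiskerLeft_comp_assoc, hg]
  rw [← associator_inv_naturality_left_assoc, whisker_exchange_assoc]
  simp

theorem whiskerLeft_coactRight {s : Y ⟶ Y ⊗ K} {s' : Y' ⟶ Y' ⊗ K} (X : C) {g : Y ⟶ Y'}
    (hg : g ≫ s' = s ≫ g ▷ K) : X ◁ g ≫ coactRight X s' = coactRight X s ≫ (X ◁ g) ▷ K := by
  simpa using tensorHom_coactRight (𝟙 X) hg

theorem whiskerRight_coactRight (f : X ⟶ X') (s : Y ⟶ Y ⊗ K) :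
    f ▷ Y ≫ coactRight X' s = coactRight X s ≫ f ▷ Y ▷ K := by
  simpa using tensorHom_coactRight f (s := s) (s' := s) (g := 𝟙 Y) (by simp)

theorem coactRight_associator (X Y : C) (t : Z ⟶ Z ⊗ K) :
    coactRight (X ⊗ Y) t ≫ (α_ X Y Z).hom ▷ K =
      (α_ X Y Z).hom ≫ coactRight X (coactRight Y t) := by
  simp only [coactRight]
  monoidal

variable [SymmetricCategory C]

theorem tensorHom_coactLeft {r : X ⟶ X ⊗ K} {r' : X' ⟶ X' ⊗ K} {f : X ⟶ X'} (g : Y ⟶ Y')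
    (hf : f ≫ r' = r ≫ f ▷ K) :
    (f ⊗ₘ g) ≫ coactLeft r' Y' = coactLeft r Y ≫ (f ⊗ₘ g) ▷ K := by
  have h := tensorHom_coactRight g hf
  rw [coactLeft_eq, coactLeft_eq, BraidedCategory.braiding_naturality_assoc, reassoc_of% h]
  simp only [Category.assoc, ← comp_whiskerRight, BraidedCategory.braiding_naturality]

theorem whiskerRight_coactLeft {r : X ⟶ X ⊗ K} {r' : X' ⟶ X' ⊗ K} {f : X ⟶ X'} (Y : C)
    (hf : f ≫ r' = r ≫ f ▷ K) : f ▷ Y ≫ coactLeft r' Y = coactLeft r Y ≫ f ▷ Y ▷ K := by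
  simpa using tensorHom_coactLeft (𝟙 Y) hf

theorem whiskerLeft_coactLeft (r : X ⟶ X ⊗ K) (g : Y ⟶ Y') :
    X ◁ g ≫ coactLeft r Y' = coactLeft r Y ≫ (X ◁ g) ▷ K := by
  simpa using tensorHom_coactLeft g (r := r) (r' := r) (f := 𝟙 X) (by simp)

theorem coactLeft_coactRight_associator (X : C) (s : Y ⟶ Y ⊗ K) (Z : C) :
    coactLeft (coactRight X s) Z ≫ (α_ X Y Z).hom ▷ K =
      (α_ X Y Z).hom ≫ coactRight X (coactLeft s Z) := by
  simp only [coactRight, coactLeft]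
  monoidal

theorem coactLeft_associator (r : X ⟶ X ⊗ K) (Y Z : C) :
    coactLeft (coactLeft r Y) Z ≫ (α_ X Y Z).hom ▷ K =
      (α_ X Y Z).hom ≫ coactLeft r (Y ⊗ Z) := by
  simp only [coactLeft, BraidedCategory.braiding_tensor_right_hom]
  monoidal

/-- Up to interchange of the last two factors, `coactLeft r Y` is `r ⊗ Y`. -/
theorem IsEqualizer.coactLeft {W : C} {i : W ⟶ X} {r r' : X ⟶ X ⊗ K} (h : IsEqualizer i r r')
    (Y : C) [Flat Y] : IsEqualizer (i ▷ Y) (coactLeft r Y) (coactLeft r' Y) :=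
  (h.whiskerRight Y).comp_mono ((α_ X K Y).hom ≫ X ◁ (β_ K Y).hom ≫ (α_ X Y K).inv)

end Coaction

/-! ### Isomorphisms of products -/

namespace ComoduleMagma

variable {C : Type u} [Category.{v} C] [MonoidalCategory C] [SymmetricCategory C]
  {H : HopfQuasigroup C}

theorem nonempty_iso {A B : ComoduleMagma H} (f : A.X ⟶ B.X) [IsIso f]
    (hf : UnitalMagma.IsHom A.toUnitalMagma B.toUnitalMagma f)
    (hc : f ≫ B.coact = A.coact ≫ f ▷ H.X) : Nonempty (A ≅ B) :=
  ⟨{ hom := Hom.mk f hf hc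
     inv := Hom.mk (inv f) (UnitalMagma.IsHom.inv (e := asIso f) hf) (by
       rw [IsIso.inv_comp_eq, reassoc_of% hc, ← comp_whiskerRight, IsIso.hom_inv_id]
       simp)
     hom_inv_id := Hom.ext (IsIso.hom_inv_id f)
     inv_hom_id := Hom.ext (IsIso.inv_hom_id f) }⟩

theorem isIso_hom {A B : ComoduleMagma H} (e : A ≅ B) : IsIso (Hom.hom e.hom) :=
  ⟨Hom.hom e.inv, congrArg Hom.hom e.hom_inv_id, congrArg Hom.hom e.inv_hom_id⟩

theorem op_congr [IsCommComonObj H.X] {A B : ComoduleMagma H} (e : A ≅ B) :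
    Nonempty (A.op ≅ B.op) := by
  let f : A.op.X ⟶ B.op.X := Hom.hom (A := A) (B := B) e.hom
  have : IsIso f := isIso_hom e
  refine nonempty_iso f (Hom.isHom e.hom).op ?_
  change Hom.hom e.hom ≫ B.coact ≫ B.X ◁ H.antipode =
    (A.coact ≫ A.X ◁ H.antipode) ≫ Hom.hom e.hom ▷ H.X
  rw [reassoc_of% (Hom.colinear e.hom), Category.assoc, whisker_exchange]

variable [HasEqualizers C] [Flat H.X]

/-- The inclusion of `A.prod B` into `A ⊗ B`. -/
noncomputable def prodIncl (A B : ComoduleMagma H) : (A.prod B).X ⟶ A.X ⊗ B.X := incl A B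

theorem isEqualizer_prodIncl (A B : ComoduleMagma H) :
    IsEqualizer (prodIncl A B) (coactLeft A.coact B.X) (coactRight A.X B.coact) :=
  isEqualizer_incl A B

theorem prodIncl_isHom (A B : ComoduleMagma H) : UnitalMagma.IsHom (A.prod B).toUnitalMagma
    (A.toUnitalMagma.tensor B.toUnitalMagma) (prodIncl A B) :=
  incl_isHom A B

theorem prodIncl_coactRight (A B : ComoduleMagma H) :
    prodIncl A B ≫ coactRight A.X B.coact = (A.prod B).coact ≫ prodIncl A B ▷ H.X :=
  (prodCoact_incl A B).symm

/-- A comodule magma that is an equalizer of the two coactions on `A ⊗ B`, compatibly with the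
structures, is isomorphic to the product of `A` and `B`. -/
theorem nonempty_iso_prod {A B T : ComoduleMagma H} {x : T.X ⟶ A.X ⊗ B.X}
    (hx : UnitalMagma.IsHom T.toUnitalMagma (A.toUnitalMagma.tensor B.toUnitalMagma) x)
    (he : IsEqualizer x (coactLeft A.coact B.X) (coactRight A.X B.coact))
    (hc : x ≫ coactRight A.X B.coact = T.coact ≫ x ▷ H.X) : Nonempty (T ≅ A.prod B) := by
  have hi := isEqualizer_prodIncl A B
  obtain ⟨y, hy⟩ := hi.exists_lift x he.condition
  have := he.isIso hi (p := y) (𝟙 _) (𝟙 _) (by simp [hy]) (by simp) (by simp)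
  have := hi.mono
  have := (hi.whiskerRight H.X).mono
  refine nonempty_iso y (UnitalMagma.IsHom.of_mono (prodIncl_isHom A B) (by rwa [hy])) ?_
  rw [← cancel_mono (prodIncl A B ▷ H.X), Category.assoc, Category.assoc, ← comp_whiskerRight, hy,
    ← hc, ← prodIncl_coactRight, reassoc_of% hy]

theorem prod_congr {A A' B B' : ComoduleMagma H} (e : A ≅ A') (e' : B ≅ B') :
    Nonempty (A.prod B ≅ A'.prod B') := by
  have := isIso_hom e
  have := isIso_hom e'
  let q := Hom.hom e.hom ⊗ₘ Hom.hom e'.hom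
  have h1 : coactLeft A.coact B.X ≫ q ▷ H.X = q ≫ coactLeft A'.coact B'.X :=
    (tensorHom_coactLeft _ (Hom.colinear e.hom)).symm
  have h2 : coactRight A.X B.coact ≫ q ▷ H.X = q ≫ coactRight A'.X B'.coact :=
    (tensorHom_coactRight _ (Hom.colinear e'.hom)).symm
  refine nonempty_iso_prod (x := prodIncl A B ≫ q)
    ((prodIncl_isHom A B).comp ((Hom.isHom e.hom).tensor (Hom.isHom e'.hom)))
    ((isEqualizer_prodIncl A B).of_iso (𝟙 _) q (q ▷ H.X) (Category.id_comp _) h1 h2) ?_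
  rw [comp_whiskerRight, ← reassoc_of% prodIncl_coactRight, Category.assoc, ← h2]

theorem prod_comm (A B : ComoduleMagma H) : Nonempty (A.prod B ≅ B.prod A) := by
  have h1 := braiding_coactLeft B.coact (Y := A.X)
  have h2 := braiding_coactRight A.coact (Y := B.X)
  have hi := isEqualizer_prodIncl A B
  have hc := hi.condition
  refine nonempty_iso_prod (x := prodIncl A B ≫ (β_ A.X B.X).hom)
    ((prodIncl_isHom A B).comp (UnitalMagma.isHom_braiding _ _)) ?_ ?_
  · have h := hi.of_iso (𝟙 _) (β_ A.X B.X).hom ((β_ A.X B.X).hom ▷ H.X)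
      (Category.id_comp _) h2.symm h1.symm
    exact .of_exists_lift h.condition.symm h.mono fun x hx => h.exists_lift x hx.symm
  · rw [comp_whiskerRight, ← reassoc_of% prodIncl_coactRight, Category.assoc, h2, reassoc_of% hc]

/-- The coaction of `A` identifies `A` with its product with `H`. -/
theorem regular_prod [IsCommComonObj H.X] (A : ComoduleMagma H) :
    Nonempty (A ≅ A.prod (regular H)) :=
  nonempty_iso_prod (B := regular H) A.coact_isHom A.isCoaction.isEqualizer A.coact_coassoc.symm

/-- Both products are the part of `A ⊗ B ⊗ D` on which the coactions of the three factors
agree. -/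
theorem prod_assoc (A B D : ComoduleMagma H) [Flat A.X] [Flat D.X] :
    Nonempty ((A.prod B).prod D ≅ A.prod (B.prod D)) := by
  let P := A.prod B
  let Q := B.prod D
  let i₁ : P.X ⟶ A.X ⊗ B.X := prodIncl A B
  let i₂ : (P.prod D).X ⟶ P.X ⊗ D.X := prodIncl P D
  let i₃ : Q.X ⟶ B.X ⊗ D.X := prodIncl B D
  have e₁ : IsEqualizer i₁ (coactLeft A.coact B.X) (coactRight A.X B.coact) :=
    isEqualizer_prodIncl A B
  have e₂ : IsEqualizer i₂ (coactLeft P.coact D.X) (coactRight P.X D.coact) :=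
    isEqualizer_prodIncl P D
  have e₃ : IsEqualizer i₃ (coactLeft B.coact D.X) (coactRight B.X D.coact) :=
    isEqualizer_prodIncl B D
  have c₁ : i₁ ≫ coactRight A.X B.coact = P.coact ≫ i₁ ▷ H.X := prodIncl_coactRight A B
  have c₂ : i₂ ≫ coactRight P.X D.coact = (P.prod D).coact ≫ i₂ ▷ H.X := prodIncl_coactRight P D
  have c₃ : i₃ ≫ coactRight B.X D.coact = Q.coact ≫ i₃ ▷ H.X := prodIncl_coactRight B D
  have m₁ : UnitalMagma.IsHom P.toUnitalMagma (A.toUnitalMagma.tensor B.toUnitalMagma) i₁ :=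
    prodIncl_isHom A B
  have m₂ : UnitalMagma.IsHom (P.prod D).toUnitalMagma
    (P.toUnitalMagma.tensor D.toUnitalMagma) i₂ := prodIncl_isHom P D
  have m₃ : UnitalMagma.IsHom Q.toUnitalMagma (B.toUnitalMagma.tensor D.toUnitalMagma) i₃ :=
    prodIncl_isHom B D
  have e₁D := e₁.coactLeft D.X
  have e₁DH := (e₁D.whiskerRight H.X).mono
  have e₃A := e₃.whiskerLeft A.X
  have e₃AH := (e₃A.whiskerRight H.X).mono
  have := e₁D.mono
  have := e₂.mono
  have := e₃A.mono
  let a := (α_ A.X B.X D.X).hom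
  -- the three coactions, on `(A ⊗ B) ⊗ D` and on `A ⊗ (B ⊗ D)`
  have a₁ : coactLeft (coactLeft A.coact B.X) D.X ≫ a ▷ H.X = a ≫ coactLeft A.coact (B.X ⊗ D.X) :=
    coactLeft_associator A.coact B.X D.X
  have a₂ : coactLeft (coactRight A.X B.coact) D.X ≫ a ▷ H.X =
    a ≫ coactRight A.X (coactLeft B.coact D.X) := coactLeft_coactRight_associator A.X B.coact D.X
  have a₃ : coactRight (A.X ⊗ B.X) D.coact ≫ a ▷ H.X =
    a ≫ coactRight A.X (coactRight B.X D.coact) := coactRight_associator A.X B.X D.coact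
  -- their restrictions to `P ⊗ D` and to `A ⊗ Q`
  have p₂ : i₁ ▷ D.X ≫ coactLeft (coactRight A.X B.coact) D.X =
    coactLeft P.coact D.X ≫ i₁ ▷ D.X ▷ H.X := whiskerRight_coactLeft D.X c₁
  have p₃ : i₁ ▷ D.X ≫ coactRight (A.X ⊗ B.X) D.coact =
    coactRight P.X D.coact ≫ i₁ ▷ D.X ▷ H.X := whiskerRight_coactRight i₁ D.coact
  have q₁ : A.X ◁ i₃ ≫ coactLeft A.coact (B.X ⊗ D.X) =
    coactLeft A.coact Q.X ≫ (A.X ◁ i₃) ▷ H.X := whiskerLeft_coactLeft A.coact i₃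
  have q₃ : A.X ◁ i₃ ≫ coactRight A.X (coactRight B.X D.coact) =
    coactRight A.X Q.coact ≫ (A.X ◁ i₃) ▷ H.X := whiskerLeft_coactRight A.X c₃
  let j := i₂ ≫ i₁ ▷ D.X ≫ a
  have j₁₂ : j ≫ coactLeft A.coact (B.X ⊗ D.X) = j ≫ coactRight A.X (coactLeft B.coact D.X) := by
    have h := e₁D.condition
    simp only [j, Category.assoc, ← a₁, ← a₂, reassoc_of% h]
  have j₂₃ : j ≫ coactRight A.X (coactLeft B.coact D.X) =
      j ≫ coactRight A.X (coactRight B.X D.coact) := by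
    have h := e₂.condition
    simp only [j, Category.assoc, ← a₂, ← a₃, reassoc_of% p₂, reassoc_of% p₃, reassoc_of% h]
  obtain ⟨x, hx⟩ := e₃A.exists_lift j (by
    rw [← cancel_mono (α_ A.X (B.X ⊗ D.X) H.X).inv]
    simpa only [coactRight, Category.assoc] using j₂₃)
  have hj : UnitalMagma.IsHom (P.prod D).toUnitalMagma
      (A.toUnitalMagma.tensor (B.toUnitalMagma.tensor D.toUnitalMagma)) j :=
    m₂.comp ((m₁.whiskerRight D.toUnitalMagma).comp (UnitalMagma.isHom_associator _ _ _))
  refine nonempty_iso_prod (T := P.prod D) (A := A) (B := Q) (x := x)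
    (UnitalMagma.IsHom.of_mono (m₃.whiskerLeft A.toUnitalMagma) (by rwa [hx]))
    (.of_exists_lift ?_ ?_ fun y hy => ?_) ?_
  · rw [← cancel_mono ((A.X ◁ i₃) ▷ H.X), Category.assoc, Category.assoc, ← q₁, ← q₃,
      reassoc_of% hx, reassoc_of% hx, j₁₂, j₂₃]
  · have : Mono (x ≫ A.X ◁ i₃) := by
      rw [hx]
      infer_instance
    exact mono_of_mono x (A.X ◁ i₃)
  · have y₁₃ : y ≫ A.X ◁ i₃ ≫ coactLeft A.coact (B.X ⊗ D.X) =
        y ≫ A.X ◁ i₃ ≫ coactRight A.X (coactRight B.X D.coact) := by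
      rw [q₁, q₃, reassoc_of% hy]
    have y₂₃ : y ≫ A.X ◁ i₃ ≫ coactRight A.X (coactLeft B.coact D.X) =
        y ≫ A.X ◁ i₃ ≫ coactRight A.X (coactRight B.X D.coact) := by
      have h := e₃A.condition
      change y ≫ A.X ◁ i₃ ≫ A.X ◁ coactLeft B.coact D.X ≫ (α_ _ _ _).inv = _
      rw [reassoc_of% h]
      rfl
    have z {t : A.X ⊗ (B.X ⊗ D.X) ⟶ (A.X ⊗ (B.X ⊗ D.X)) ⊗ H.X}
        {t' : (A.X ⊗ B.X) ⊗ D.X ⟶ ((A.X ⊗ B.X) ⊗ D.X) ⊗ H.X} (h : t' ≫ a ▷ H.X = a ≫ t) :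
        y ≫ A.X ◁ i₃ ≫ inv a ≫ t' ≫ a ▷ H.X = y ≫ A.X ◁ i₃ ≫ t := by
      simp [h]
    obtain ⟨w, hw⟩ := e₁D.exists_lift (y ≫ A.X ◁ i₃ ≫ inv a) (by
      rw [← cancel_mono (a ▷ H.X)]
      simp only [Category.assoc, z a₁, z a₂, y₁₃, y₂₃])
    obtain ⟨u, hu⟩ := e₂.exists_lift w (by
      rw [← cancel_mono (i₁ ▷ D.X ▷ H.X), Category.assoc, Category.assoc, ← p₂, ← p₃,
        reassoc_of% hw, reassoc_of% hw, ← cancel_mono (a ▷ H.X)]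
      simp only [Category.assoc, z a₂, z a₃, y₂₃])
    refine ⟨u, ?_⟩
    rw [← cancel_mono (A.X ◁ i₃), Category.assoc, hx]
    simp only [j, reassoc_of% hu, reassoc_of% hw, IsIso.inv_hom_id, Category.comp_id]
  · rw [← cancel_mono ((A.X ◁ i₃) ▷ H.X), Category.assoc, Category.assoc, ← q₃, reassoc_of% hx,
      ← comp_whiskerRight, hx]
    simp only [j, comp_whiskerRight, Category.assoc, ← reassoc_of% c₂, ← a₃, reassoc_of% p₃]

/-- The translation morphism identifies `H` with the product of the opposite of `A` with `A`; strength
of `A` is what makes it a morphism of unital magmas. -/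
theorem op_prod [IsCommComonObj H.X] {A : ComoduleMagma H} (hA : IsStrongGalois A) :
    Nonempty (regular H ≅ A.op.prod A) := by
  have := hA.isIso_can
  exact nonempty_iso_prod (A := A.op) (T := regular H) hA.translation_isHom
    (isEqualizer_translation hA.toIsGalois) A.translation_coactRight

end ComoduleMagma

/-! ### The monoid and the group of isomorphism classes -/

section Monoid

variable {C : Type u} [Category.{v} C] [MonoidalCategory C] [SymmetricCategory C]
  {H : HopfQuasigroup C}

theorem isoClass_eq_of_nonempty_iso {P : ObjectProperty (ComoduleMagma H)} {A B : P.FullSubcategory}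
    (h : Nonempty (A.obj ≅ B.obj)) : isoClass A = isoClass B :=
  Quotient.sound ⟨P.isoMk h.some⟩

variable [HasEqualizers C] [IsCommComonObj H.X] [FaithfullyFlat H.X]

/-- The commutative monoid of isomorphism classes of the comodule magmas in a class of flat
objects that contains `H` and is closed under products. -/
noncomputable abbrev isoClassesCommMonoid (P : ObjectProperty (ComoduleMagma H))
    (hflat : ∀ A, P A → Flat A.X) (hone : P (.regular H))
    (hmul : ∀ A B, P A → P B → P (A.prod B)) : CommMonoid (IsoClasses P.FullSubcategory) where
  mul := Quotient.map₂ (fun A B => ⟨A.obj.prod B.obj, hmul _ _ A.property B.property⟩)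
    fun _ _ ⟨e⟩ _ _ ⟨e'⟩ => ⟨P.isoMk
      (ComoduleMagma.prod_congr (P.ι.mapIso e) (P.ι.mapIso e')).some⟩
  one := isoClass ⟨.regular H, hone⟩
  mul_assoc := by
    rintro ⟨A⟩ ⟨B⟩ ⟨D⟩
    have := hflat _ A.property
    have := hflat _ D.property
    exact isoClass_eq_of_nonempty_iso (ComoduleMagma.prod_assoc A.obj B.obj D.obj)
  mul_comm := by
    rintro ⟨A⟩ ⟨B⟩
    exact isoClass_eq_of_nonempty_iso (ComoduleMagma.prod_comm A.obj B.obj)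
  mul_one := by
    rintro ⟨A⟩
    exact isoClass_eq_of_nonempty_iso (A.obj.regular_prod.map Iso.symm)
  one_mul := by
    rintro ⟨A⟩
    exact isoClass_eq_of_nonempty_iso ((ComoduleMagma.prod_comm _ _).map2 (· ≪≫ ·)
      (A.obj.regular_prod.map Iso.symm))

end Monoid

end GaloisHopf

theorem theorem2p10 {C : Type u} [Category.{v} C] [MonoidalCategory C] [SymmetricCategory C]
    [HasEqualizers C] (H : HopfQuasigroup C) [IsCommComonObj H.X] [FaithfullyFlat H.X] :
    (∃ M : CommMonoid (IsoClasses (GaloisObj H)),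
      (∀ A B : GaloisObj H, ∃ hAB : IsGalois (A.obj.prod B.obj),
        M.mul (isoClass A) (isoClass B) = isoClass ⟨A.obj.prod B.obj, hAB⟩) ∧
      (∃ hH : IsGalois (ComoduleMagma.regular H),
        M.one = isoClass ⟨ComoduleMagma.regular H, hH⟩)) ∧
    (∃ G : CommGroup (IsoClasses (StrongGaloisObj H)),
      (∀ A B : StrongGaloisObj H, ∃ hAB : IsStrongGalois (A.obj.prod B.obj),
        G.mul (isoClass A) (isoClass B) = isoClass ⟨A.obj.prod B.obj, hAB⟩) ∧
      (∃ hH : IsStrongGalois (ComoduleMagma.regular H),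
        G.one = isoClass ⟨ComoduleMagma.regular H, hH⟩) ∧
      (∀ A : StrongGaloisObj H, ∃ hA : IsStrongGalois A.obj.op,
        G.inv (isoClass A) = isoClass ⟨A.obj.op, hA⟩)) := by
  refine ⟨⟨isoClassesCommMonoid _ (fun A hA => hA.faithfullyFlat.toFlat) isGalois_regular
    (fun A B hA hB => hA.prod hB), fun A B => ⟨_, rfl⟩, ⟨_, rfl⟩⟩, ?_⟩
  let inv : IsoClasses (StrongGaloisObj H) → IsoClasses (StrongGaloisObj H) :=
    Quotient.map (fun A => ⟨A.obj.op, A.property.op⟩) fun _ _ ⟨e⟩ =>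
      ⟨ObjectProperty.isoMk _ (ComoduleMagma.op_congr ((ObjectProperty.ι _).mapIso e)).some⟩
  let M : CommMonoid (IsoClasses (StrongGaloisObj H)) :=
    isoClassesCommMonoid _ (fun A hA => hA.faithfullyFlat.toFlat) isStrongGalois_regular
      (fun A B hA hB => hA.prod hB)
  refine ⟨{ M with
    inv := inv
    inv_mul_cancel := ?_ }, fun A B => ⟨_, rfl⟩, ⟨_, rfl⟩, fun A => ⟨_, rfl⟩⟩
  rintro ⟨A⟩
  exact isoClass_eq_of_nonempty_iso ((ComoduleMagma.op_prod A.property).map Iso.symm)
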